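/- Label the pairs $(i,j)$, $1\le i\le 2$, $1\le j\le 3$, by $1,\dots,6$ row by row, so that $(1,1),(1,2),(1,3),(2,1),(2,2),(2,3)$ have the labels $1,2,3,4,5,6$, and let $\theta$ be the permutation of these pairs given by the 6-cycle $(1\,2\,4\,6\,5\,3)\in S_6$, that is, $1\to2\to4\to6\to5\to3\to1$. Let $\Lambda=\mathbb F_\theta^+$ be the single vertex 2-graph defined by $\theta$, that is, the unital semigroup with generators $e_1,e_2,f_1,f_2,f_3$ subject only to the relations $e_if_j=f_{j'}e_{i'}$ whenever $\theta(i,j)=(i',j')$; this semigroup is (left and right) cancellative. For a cancellative unital semigroup $S$ let $\mathcal H_S=\ell^2(S)$ with its standard orthonormal basis $\{\xi_w:w\in S\}$, let $L_v$ ($v\in S$) be the isometry on $\mathcal H_S$ with $L_v\xi_w=\xi_{vw}$ for all $w\in S$, and let $\mathfrak L_S$ be the algebra of bounded operators on $\mathcal H_S$ that is generated, as an algebra closed in the weak operator topology, by $\{L_v:v\in S\}$. Let $\Lambda^{op}$ be the opposite semigroup of $\Lambda$. Then: (i) the commutant of $\mathfrak L_\Lambda$ is $\mathfrak L_{\Lambda^{op}}$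 up to the canonical unitary equivalence: there is a unitary $W:\mathcal H_\Lambda\to\mathcal H_{\Lambda^{op}}$ with $W\xi_w=\xi_{w^{op}}$ for all $w\in\Lambda$, where $w^{op}$ denotes $w$ regarded as an element of $\Lambda^{op}$, and a bounded operator $T$ on $\mathcal H_\Lambda$ commutes with every element of $\mathfrak L_\Lambda$ if and only if $WTW^*\in\mathfrak L_{\Lambda^{op}}$; (ii) $\mathfrak L_\Lambda$ is not isometrically isomorphic to its commutant: there is no isomorphism of complex algebras from $\mathfrak L_\Lambda$ onto its commutant which preserves the operator norm. -/

import Mathlib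

open scoped ENNReal

noncomputable section

/-! ### Single vertex 2-graphs, identified with their bigraded unital semigroups -/

/-- The commutation relations `e_i f_j = f_{j'} e_{i'}`, where `θ (i, j) = (i', j')`.
The generator `e_i` is `Sum.inl i` and the generator `f_j` is `Sum.inr j`. -/
inductive TwoGraphRel {n m : ℕ} (θ : Equiv.Perm (Fin n × Fin m)) :
    FreeMonoid (Fin n ⊕ Fin m) → FreeMonoid (Fin n ⊕ Fin m) → Prop
  | comm (i : Fin n) (j : Fin m) : TwoGraphRel θ
      (FreeMonoid.of (Sum.inl i) * FreeMonoid.of (Sum.inr j))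
      (FreeMonoid.of (Sum.inr (θ (i, j)).2) * FreeMonoid.of (Sum.inl (θ (i, j)).1))

/-- The unital semigroup `𝔽⁺_θ = 𝔽⁺_n ×_θ 𝔽⁺_m` of the single vertex 2-graph defined by `θ`:
the universal monoid with generators `e_1, …, e_n, f_1, …, f_m` subject to the relations
`e_i f_j = f_{j'} e_{i'}`, where `θ (i, j) = (i', j')`. -/
abbrev TwoGraph {n m : ℕ} (θ : Equiv.Perm (Fin n × Fin m)) : Type :=
  PresentedMonoid (TwoGraphRel θ)

namespace TwoGraph

/-! The semigroup `𝔽⁺_θ` is cancellative (this is needed for the shifts to be isometries):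
it acts from the right on pairs of words by injective maps, and the action is faithful on the
empty pair. -/

section cancel

variable {n m : ℕ} (θ : Equiv.Perm (Fin n × Fin m))

/-- Move the letter `e_i` to the left through a word in the `f_j`
(the word is stored with its last letter first). -/
def slide : Fin n → List (Fin m) → Fin n × List (Fin m)
  | i, [] => (i, [])
  | i, j :: v => ((slide (θ.symm (i, j)).1 v).1, (θ.symm (i, j)).2 :: (slide (θ.symm (i, j)).1 v).2)

/-- Right multiplication of a factored word `w_1(e) w_2(f)` by a generator. -/
def act : Fin n ⊕ Fin m → List (Fin n) × List (Fin m) → List (Fin n) × List (Fin m)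
  | Sum.inl i, p => ((slide θ i p.2).1 :: p.1, (slide θ i p.2).2)
  | Sum.inr j, p => (p.1, j :: p.2)

theorem slide_inj : ∀ (v w : List (Fin m)) (i k : Fin n),
    slide θ i v = slide θ k w → i = k ∧ v = w
  | [], [], i, k, h => by simpa [slide] using h
  | [], _ :: _, i, k, h => by simp [slide] at h
  | _ :: _, [], i, k, h => by simp [slide] at h
  | j :: v, l :: w, i, k, h => by
    simp only [slide, Prod.mk.injEq, List.cons.injEq] at h
    obtain ⟨h1, h2, h3⟩ := h
    obtain ⟨h4, h5⟩ := slide_inj v w _ _ (Prod.ext h1 h3)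
    have h6 := θ.symm.injective (Prod.ext h4 h2)
    simp only [Prod.mk.injEq] at h6
    exact ⟨h6.1, by rw [h6.2, h5]⟩

theorem act_injective (x : Fin n ⊕ Fin m) : Function.Injective (act θ x) := by
  rintro ⟨u, v⟩ ⟨u', v'⟩ h
  rcases x with i | j
  · simp only [act, Prod.mk.injEq, List.cons.injEq] at h
    obtain ⟨-, h⟩ := slide_inj θ v v' i i (Prod.ext h.1.1 h.2)
    simp_all
  · simpa [act] using h

/-- The right action of `𝔽⁺_θ` on factored words. -/
def action : TwoGraph θ →* (Function.End (List (Fin n) × List (Fin m)))ᵐᵒᵖ :=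
  PresentedMonoid.lift
    (M := (Function.End (List (Fin n) × List (Fin m)))ᵐᵒᵖ)
    (fun x => MulOpposite.op (act θ x)) (by
    rintro _ _ ⟨i, j⟩
    simp only [map_mul, FreeMonoid.lift_eval_of]
    apply MulOpposite.unop_injective
    funext p
    change act θ (Sum.inr j) (act θ (Sum.inl i) p) =
      act θ (Sum.inl (θ (i, j)).1) (act θ (Sum.inr (θ (i, j)).2) p)
    simp [act, slide])

/-- The right action, applied to a factored word. -/
def actBy (s : TwoGraph θ) (p : List (Fin n) × List (Fin m)) : List (Fin n) × List (Fin m) :=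
  (action θ s).unop p

theorem actBy_one (p : List (Fin n) × List (Fin m)) : actBy θ 1 p = p := by
  simp only [actBy, map_one]
  rfl

theorem actBy_of (x : Fin n ⊕ Fin m) (p : List (Fin n) × List (Fin m)) :
    actBy θ (PresentedMonoid.mk (TwoGraphRel θ) (FreeMonoid.of x)) p = act θ x p := rfl

theorem actBy_mul (s t : TwoGraph θ) (p : List (Fin n) × List (Fin m)) :
    actBy θ (s * t) p = actBy θ t (actBy θ s p) := by
  simp only [actBy, map_mul]
  rfl

/-- The element of `𝔽⁺_θ` given by a factored word. -/
def eval (p : List (Fin n) × List (Fin m)) : TwoGraph θ :=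
  (p.1.reverse.map fun i => PresentedMonoid.of (TwoGraphRel θ) (Sum.inl i)).prod *
    (p.2.reverse.map fun j => PresentedMonoid.of (TwoGraphRel θ) (Sum.inr j)).prod

theorem of_inl_mul_of_inr (i : Fin n) (j : Fin m) :
    PresentedMonoid.of (TwoGraphRel θ) (Sum.inl i) * PresentedMonoid.of (TwoGraphRel θ) (Sum.inr j)
      = PresentedMonoid.of (TwoGraphRel θ) (Sum.inr (θ (i, j)).2) *
        PresentedMonoid.of (TwoGraphRel θ) (Sum.inl (θ (i, j)).1) :=
  PresentedMonoid.mk_eq_mk_of_rel (TwoGraphRel.comm i j)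

theorem prod_mul_of_inl : ∀ (v : List (Fin m)) (i : Fin n),
    (v.reverse.map fun j => PresentedMonoid.of (TwoGraphRel θ) (Sum.inr j)).prod *
      PresentedMonoid.of (TwoGraphRel θ) (Sum.inl i) =
    PresentedMonoid.of (TwoGraphRel θ) (Sum.inl (slide θ i v).1) *
      ((slide θ i v).2.reverse.map fun j => PresentedMonoid.of (TwoGraphRel θ) (Sum.inr j)).prod
  | [], i => by simp [slide]
  | j :: v, i => by
    have h := of_inl_mul_of_inr θ (θ.symm (i, j)).1 (θ.symm (i, j)).2
    have ih := prod_mul_of_inl v (θ.symm (i, j)).1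
    simp only [Prod.mk.eta, Equiv.apply_symm_apply] at h
    simp only [slide, List.reverse_cons, List.map_append, List.map_cons, List.map_nil,
      List.prod_append, List.prod_cons, List.prod_nil, mul_one]
    rw [mul_assoc, ← h, ← mul_assoc, ih, mul_assoc]

theorem eval_act (x : Fin n ⊕ Fin m) (p : List (Fin n) × List (Fin m)) :
    eval θ (act θ x p) = eval θ p * PresentedMonoid.of (TwoGraphRel θ) x := by
  rcases x with i | j
  · have h := prod_mul_of_inl θ p.2 i
    simp only [eval, act]
    rw [mul_assoc, h]
    simp [mul_assoc]
  · simp [eval, act, mul_assoc]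

theorem eval_actBy (s : TwoGraph θ) : ∀ p, eval θ (actBy θ s p) = eval θ p * s := by
  obtain ⟨w, rfl⟩ := PresentedMonoid.surjective_mk s
  induction w with
  | one => intro p; rw [map_one, actBy_one, mul_one]
  | of x => intro p; rw [actBy_of, eval_act]; rfl
  | mul x y hx hy => intro p; rw [map_mul, actBy_mul, hy, hx, mul_assoc]

theorem actBy_injective (s : TwoGraph θ) : Function.Injective (actBy θ s) := by
  obtain ⟨w, rfl⟩ := PresentedMonoid.surjective_mk s
  induction w with
  | one => intro p q h; simpa only [map_one, actBy_one] using h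
  | of x => intro p q h; exact act_injective θ x (by simpa only [actBy_of] using h)
  | mul x y hx hy =>
    intro p q h
    simp only [map_mul, actBy_mul] at h
    exact hx (hy h)

theorem mul_right_cancel_aux (a b c : TwoGraph θ) (h : a * b = c * b) : a = c := by
  have h1 := congrArg (fun s => actBy θ s ([], [])) h
  simp only [actBy_mul] at h1
  have h2 := congrArg (eval θ) (actBy_injective θ b h1)
  have h3 : eval θ ([], []) = 1 := by simp [eval]
  simpa only [eval_actBy, h3, one_mul] using h2

/-- Reversal of words, from `𝔽⁺_θ` to the opposite of the semigroup of the inverse permutation. -/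
def rev : TwoGraph θ →* (TwoGraph θ.symm)ᵐᵒᵖ :=
  PresentedMonoid.lift (fun x => MulOpposite.op (PresentedMonoid.of (TwoGraphRel θ.symm) x)) (by
    rintro _ _ ⟨i, j⟩
    simp only [map_mul, FreeMonoid.lift_eval_of, ← MulOpposite.op_mul]
    have h := of_inl_mul_of_inr θ.symm (θ (i, j)).1 (θ (i, j)).2
    simp only [Prod.mk.eta, Equiv.symm_apply_apply] at h
    rw [h])

theorem rev_rev (s : TwoGraph θ) : (rev θ.symm (rev θ s).unop).unop = s := by
  obtain ⟨w, rfl⟩ := PresentedMonoid.surjective_mk s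
  induction w with
  | one => simp
  | of x => rfl
  | mul x y hx hy =>
    simp only [map_mul, MulOpposite.unop_mul]
    rw [hx, hy]

theorem mul_left_cancel_aux (a b c : TwoGraph θ) (h : a * b = a * c) : b = c := by
  have h1 := congrArg (fun s => (rev θ s).unop) h
  simp only [map_mul, MulOpposite.unop_mul] at h1
  have h2 := mul_right_cancel_aux θ.symm _ _ _ h1
  have h3 := congrArg (fun s => (rev θ.symm s).unop) h2
  simpa only [rev_rev] using h3

instance : IsCancelMul (TwoGraph θ) where
  mul_left_cancel a b c h := mul_left_cancel_aux θ a b c h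
  mul_right_cancel b a c h := mul_right_cancel_aux θ a b c h

end cancel

end TwoGraph

/-! ### The analytic Toeplitz algebra of a cancellative semigroup -/

/-- The Fock space `ℋ_S = ℓ²(S)`. -/
abbrev FockSpace (S : Type*) : Type _ := lp (fun _ : S => ℂ) 2

open Classical in
/-- The standard orthonormal basis vectors `ξ_w`, `w ∈ S`, of the Fock space. -/
def fockBasis {S : Type*} (w : S) : FockSpace S := lp.single 2 w (1 : ℂ)

theorem orthonormal_fockBasis (S : Type*) : Orthonormal ℂ (fockBasis : S → FockSpace S) := by
  classical
  rw [orthonormal_iff_ite]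
  intro v w
  rw [fockBasis, fockBasis, lp.inner_single_left, lp.single_apply]
  by_cases h : v = w
  · subst h; simp
  · simp [h]

/-- The left shift `L_v` on the Fock space, as a linear isometry: `L_v ξ_w = ξ_{vw}`. -/
def leftShift {S : Type*} [Monoid S] [IsCancelMul S] (v : S) : FockSpace S →ₗᵢ[ℂ] FockSpace S :=
  ((orthonormal_fockBasis S).comp (fun w => v * w)
    (mul_right_injective v)).orthogonalFamily.linearIsometry

theorem leftShift_fockBasis {S : Type*} [Monoid S] [IsCancelMul S] (v w : S) :
    leftShift v (fockBasis w) = fockBasis (v * w) := by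
  classical
  conv_lhs => rw [fockBasis]
  rw [leftShift, OrthogonalFamily.linearIsometry_apply_single]
  simp

/-- An algebra of bounded operators is closed in the weak operator topology. -/
def IsWOTClosed {H : Type*} [NormedAddCommGroup H] [InnerProductSpace ℂ H]
    (A : Subalgebra ℂ (H →L[ℂ] H)) : Prop :=
  IsClosed {T : H →WOT[ℂ] H | T.toCLM ∈ A}

/-- The analytic Toeplitz algebra `𝔏_S`: the algebra on the Fock space which is generated, as a
WOT-closed algebra, by the left shifts `L_v`, `v ∈ S`, that is, the smallest WOT-closed algebra
which contains them. (It contains the identity operator, the shift by the unit of `S`.) -/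
def analyticToeplitz (S : Type*) [Monoid S] [IsCancelMul S] :
    Subalgebra ℂ (FockSpace S →L[ℂ] FockSpace S) :=
  sInf {A | (∀ v : S, (leftShift v).toContinuousLinearMap ∈ A) ∧ IsWOTClosed A}

/-- The commutant of an algebra of bounded operators. -/
def commutant {H : Type*} [NormedAddCommGroup H] [InnerProductSpace ℂ H]
    (A : Subalgebra ℂ (H →L[ℂ] H)) : Subalgebra ℂ (H →L[ℂ] H) :=
  Subalgebra.centralizer ℂ (A : Set (H →L[ℂ] H))

/-- Two operator algebras are isometrically isomorphic: there is an isomorphism of complex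
algebras between them which preserves the operator norm. -/
def IsometricallyIsomorphic {H K : Type*} [NormedAddCommGroup H] [InnerProductSpace ℂ H]
    [NormedAddCommGroup K] [InnerProductSpace ℂ K]
    (A : Subalgebra ℂ (H →L[ℂ] H)) (B : Subalgebra ℂ (K →L[ℂ] K)) : Prop :=
  ∃ Φ : A ≃ₐ[ℂ] B, ∀ T : A, ‖(Φ T : K →L[ℂ] K)‖ = ‖(T : H →L[ℂ] H)‖

/-! ### The permutation `(1 2 4 6 5 3)` -/

/-- The 6-cycle `1 → 2 → 4 → 6 → 5 → 3 → 1` of `S_6`, as a permutation of the cells of a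
`2 × 3` array. The cells are labelled `1, 2, 3` along the first row and `4, 5, 6` along the
second, so that `finProdFinEquiv (i, j) = j + 3 * i` is the label minus one. -/
def theta124653 : Equiv.Perm (Fin 2 × Fin 3) :=
  finProdFinEquiv.symm.permCongr (List.formPerm [(0 : Fin (2 * 3)), 1, 3, 5, 4, 2])

end

noncomputable section

open scoped InnerProductSpace

/-! ### Operators on the Fock space in coordinates -/

namespace FockSpace

variable {S S' : Type*}

/-! Commutant. An operator commuting with all right shifts is a Toeplitz-type matrix: its entry at
`(v * w, w)` depends only on `v`, and all other entries vanish. Grading `S` by word length, its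
Cesàro means are polynomials in the left shifts, bounded in norm by the operator and WOT-convergent
to it. So `𝔏_S` is exactly the set of operators commuting with the right shifts
(`mem_analyticToeplitz_iff`). Passing to `Sᵐᵒᵖ` turns left shifts into right shifts, which
identifies the commutant.

Non-isomorphism. Let `Φ` be an isometric isomorphism onto the commutant. The vacuum coefficient is a
character there; let `ψ` be its pullback. Its values on the `e_i`, and likewise on the `f_j`, lie in
the open unit ball (`sum_norm_sq_coef_lt_one`). The degree-one coefficients of `Φ T` are point
derivations at `ψ`, and their values on the generators form an invertible matrix `M`
(`isUnit_det_linearPart`). Indeed, a combination of them killing all generators is a bounded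
functional on which generators act as scalars of length less than one; `functional_eq_zero` makes it
vanish, whereas it takes arbitrary values on preimages of the right shifts by generators.

Hence the differentiated relations hold at `ψ` in every tangent direction (`tangent_relation`),
which for this 6-cycle forces `ψ = 0` on generators. Now the degree-two coefficients of the
relations say that `M` carries the quadratic relations of `θ` to those of the opposite semigroup.
This makes `M` block diagonal, with blocks `E` and `F` such that `E ⊗ F` conjugates `θ` to its
inverse; for this `θ` no such invertible `E`, `F` exist (`det_eq_zero_of_relations`). -/

theorem inner_fockBasis_left (w : S) (x : FockSpace S) : ⟪fockBasis w, x⟫_ℂ = x w := by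
  classical
  rw [fockBasis, lp.inner_single_left]
  simp

theorem inner_fockBasis_right (w : S) (x : FockSpace S) :
    ⟪x, fockBasis w⟫_ℂ = starRingEnd ℂ (x w) := by
  rw [← inner_conj_symm, inner_fockBasis_left]

open Classical in
theorem fockBasis_apply (w u : S) : fockBasis w u = if u = w then 1 else 0 := by
  rw [← inner_fockBasis_left, orthonormal_iff_ite.1 (orthonormal_fockBasis S)]

theorem fockBasis_apply_self (w : S) : fockBasis w w = 1 := by
  simp [fockBasis_apply]

theorem fockBasis_apply_ne {w u : S} (h : u ≠ w) : fockBasis w u = 0 := by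
  simp [fockBasis_apply, h]

theorem norm_fockBasis (w : S) : ‖(fockBasis w : FockSpace S)‖ = 1 :=
  (orthonormal_fockBasis S).1 w

theorem norm_apply_le (x : FockSpace S) (w : S) : ‖x w‖ ≤ ‖x‖ :=
  lp.norm_apply_le_norm (by norm_num) x w

theorem hasSum_fockBasis (x : FockSpace S) : HasSum (fun w => x w • fockBasis w) x := by
  classical
  convert lp.hasSum_single (p := 2) (by norm_num) x using 2 with w
  rw [fockBasis, ← lp.single_smul]
  simp

theorem clm_ext {F : Type*} [NormedAddCommGroup F] [NormedSpace ℂ F]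
    {T T' : FockSpace S →L[ℂ] F} (h : ∀ w, T (fockBasis w) = T' (fockBasis w)) : T = T' := by
  ext x
  have h1 := T.hasSum (hasSum_fockBasis x)
  have h2 := T'.hasSum (hasSum_fockBasis x)
  simp only [map_smul] at h1 h2
  simp only [h] at h1
  exact h1.unique h2

theorem clm_ext_apply {T T' : FockSpace S →L[ℂ] FockSpace S'}
    (h : ∀ w u, T (fockBasis w) u = T' (fockBasis w) u) : T = T' :=
  clm_ext fun w => by ext u; exact h w u

/-- Evaluation at a coordinate. -/
def coord (u : S) : FockSpace S →L[ℂ] ℂ := innerSL ℂ (fockBasis u)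

theorem coord_apply (u : S) (x : FockSpace S) : coord u x = x u := by
  simp [coord, inner_fockBasis_left]

/-- The isometry which maps the basis vectors by an injection of the index sets. -/
def basisMap (f : S → S') (hf : Function.Injective f) : FockSpace S →ₗᵢ[ℂ] FockSpace S' :=
  ((orthonormal_fockBasis S').comp f hf).orthogonalFamily.linearIsometry

theorem basisMap_fockBasis (f : S → S') (hf : Function.Injective f) (w : S) :
    basisMap f hf (fockBasis w) = fockBasis (f w) := by
  classical
  conv_lhs => rw [fockBasis]
  rw [basisMap, OrthogonalFamily.linearIsometry_apply_single]
  simp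

theorem basisMap_apply (f : S → S') (hf : Function.Injective f) (x : FockSpace S) (u : S) :
    basisMap f hf x (f u) = x u := by
  rw [← inner_fockBasis_left, ← basisMap_fockBasis f hf, LinearIsometry.inner_map_map,
    inner_fockBasis_left]

theorem basisMap_apply_eq_zero (f : S → S') (hf : Function.Injective f) (x : FockSpace S) {v : S'}
    (hv : ∀ u, f u ≠ v) : basisMap f hf x v = 0 := by
  have : coord v ∘L (basisMap f hf).toContinuousLinearMap = 0 := clm_ext fun w => by
    simp [coord_apply, basisMap_fockBasis, fockBasis_apply_ne (hv w).symm]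
  simpa [coord_apply] using congrArg (fun T => T x) this

/-! ### Left and right shifts and their matrix entries -/

section Monoid

variable [Monoid S] [IsCancelMul S]

/-- The left shift as a bounded operator. -/
def lShift (v : S) : FockSpace S →L[ℂ] FockSpace S := (leftShift v).toContinuousLinearMap

/-- The right shift as a bounded operator. -/
def rShift (v : S) : FockSpace S →L[ℂ] FockSpace S :=
  (basisMap (fun w => w * v) (mul_left_injective v)).toContinuousLinearMap

@[simp] theorem lShift_fockBasis (v w : S) : lShift v (fockBasis w) = fockBasis (v * w) :=
  leftShift_fockBasis v w

@[simp] theorem rShift_fockBasis (v w : S) : rShift v (fockBasis w) = fockBasis (w * v) :=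
  basisMap_fockBasis (fun w => w * v) (mul_left_injective v) w

@[simp] theorem lShift_apply_mul (v u : S) (x : FockSpace S) : lShift v x (v * u) = x u :=
  basisMap_apply (fun w => v * w) (mul_right_injective v) x u

theorem lShift_apply_eq_zero (v : S) {u : S} (x : FockSpace S) (h : ∀ t, v * t ≠ u) :
    lShift v x u = 0 :=
  basisMap_apply_eq_zero (fun w => v * w) (mul_right_injective v) x h

@[simp] theorem rShift_apply_mul (v u : S) (x : FockSpace S) : rShift v x (u * v) = x u :=
  basisMap_apply (fun w => w * v) (mul_left_injective v) x u

theorem rShift_apply_eq_zero (v : S) {u : S} (x : FockSpace S) (h : ∀ t, t * v ≠ u) :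
    rShift v x u = 0 :=
  basisMap_apply_eq_zero (fun w => w * v) (mul_left_injective v) x h

theorem lShift_mul_rShift (v w : S) : lShift v * rShift w = rShift w * lShift v :=
  clm_ext fun u => by simp [mul_assoc]

theorem lShift_mul (v w : S) : lShift (v * w) = lShift v * lShift w :=
  clm_ext fun u => by simp [mul_assoc]

theorem lShift_one : lShift (1 : S) = 1 := clm_ext fun u => by simp

theorem norm_lShift_apply (v : S) (x : FockSpace S) : ‖lShift v x‖ = ‖x‖ :=
  (leftShift v).norm_map x

/-- The adjoint of the left shift. -/
def lShiftAdj (v : S) : FockSpace S →L[ℂ] FockSpace S := ContinuousLinearMap.adjoint (lShift v)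

@[simp] theorem lShiftAdj_apply (v u : S) (x : FockSpace S) : lShiftAdj v x u = x (v * u) := by
  rw [← inner_fockBasis_left, lShiftAdj, ContinuousLinearMap.adjoint_inner_right,
    lShift_fockBasis, inner_fockBasis_left]

end Monoid

/-! ### Block Schur multipliers -/

theorem hasSum_norm_sq (x : FockSpace S) : HasSum (fun w => ‖x w‖ ^ 2) (‖x‖ ^ 2) := by
  simpa using lp.hasSum_norm (p := 2) (by norm_num) x

theorem sum_norm_sq_le (x : FockSpace S) (s : Finset S) : ∑ w ∈ s, ‖x w‖ ^ 2 ≤ ‖x‖ ^ 2 :=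
  sum_le_hasSum s (fun _ _ => by positivity) (hasSum_norm_sq x)

theorem memℓp_of_sum_le {f : S → ℂ} {C : ℝ} (h : ∀ s : Finset S, ∑ w ∈ s, ‖f w‖ ^ 2 ≤ C) :
    Memℓp f 2 :=
  memℓp_gen' (C := C) fun s => by simpa using h s

theorem norm_le_of_sum_le {x : FockSpace S} {C : ℝ} (hC : 0 ≤ C)
    (h : ∀ s : Finset S, ∑ w ∈ s, ‖x w‖ ^ 2 ≤ C ^ 2) : ‖x‖ ≤ C :=
  lp.norm_le_of_forall_sum_le (p := 2) (by norm_num) hC fun s => by simpa using h s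

open Classical in
/-- The restriction of a vector to a subset of the basis. -/
def restrict (A : Set S) : FockSpace S →ₗ[ℂ] FockSpace S where
  toFun x := ⟨fun w => if w ∈ A then x w else 0, memℓp_of_sum_le (C := ‖x‖ ^ 2) fun s =>
    (Finset.sum_le_sum fun w _ => by split_ifs <;> simp).trans (sum_norm_sq_le x s)⟩
  map_add' x y := by
    ext w
    change (if w ∈ A then x w + y w else 0) =
      (if w ∈ A then x w else 0) + (if w ∈ A then y w else 0)
    split_ifs <;> simp
  map_smul' c x := by
    ext w
    by_cases h : w ∈ A <;> simp [h]

open Classical in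
theorem restrict_apply (A : Set S) (x : FockSpace S) (w : S) :
    restrict A x w = if w ∈ A then x w else 0 := rfl

open Classical in
theorem restrict_fockBasis (A : Set S) (w : S) :
    restrict A (fockBasis w) = if w ∈ A then fockBasis w else 0 := by
  ext u
  rw [restrict_apply]
  by_cases h : u = w
  · subst h
    by_cases h' : u ∈ A <;> simp [h']
  · split_ifs <;> simp [fockBasis_apply_ne h]

/-- Each basis vector is counted by at most `n` of the overlapping projections. -/
theorem sum_norm_sq_restrict_le (x : FockSpace S) (B : S → Finset ℕ) {n : ℕ}
    (hB : ∀ w, (B w).card ≤ n) (M : Finset ℕ) :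
    ∑ m ∈ M, ‖restrict {w | m ∈ B w} x‖ ^ 2 ≤ n * ‖x‖ ^ 2 := by
  have h1 := hasSum_sum fun m (_ : m ∈ M) => hasSum_norm_sq (restrict {w | m ∈ B w} x)
  refine hasSum_le (fun w => ?_) h1 ((hasSum_norm_sq x).mul_left (n : ℝ))
  have h2 : ∀ m, ‖restrict {w | m ∈ B w} x w‖ ^ 2 = if m ∈ B w then ‖x w‖ ^ 2 else 0 := by
    intro m
    by_cases h : m ∈ B w <;> simp [restrict_apply, h]
  simp only [h2]
  rw [← Finset.sum_filter, Finset.sum_const, nsmul_eq_mul]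
  refine mul_le_mul_of_nonneg_right ?_ (by positivity)
  refine Nat.cast_le.2 (le_trans (Finset.card_le_card fun m hm => ?_) (hB w))
  exact (Finset.mem_filter.1 hm).2

/-- Cauchy–Schwarz over the at most `n` indices in `A u` costs one factor `n`; the overlap of the
sets `B w` costs the other. -/
theorem sum_blockSchur_le (T : FockSpace S →L[ℂ] FockSpace S) (A B : S → Finset ℕ) {n : ℕ}
    (hA : ∀ w, (A w).card ≤ n) (hB : ∀ w, (B w).card ≤ n) (x : FockSpace S) (s : Finset S) :
    ∑ u ∈ s, ‖∑ m ∈ A u, T (restrict {w | m ∈ B w} x) u‖ ^ 2 ≤ (n * ‖T‖ * ‖x‖) ^ 2 := by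
  classical
  set z : ℕ → FockSpace S := fun m => T (restrict {w | m ∈ B w} x)
  calc ∑ u ∈ s, ‖∑ m ∈ A u, z m u‖ ^ 2
      ≤ ∑ u ∈ s, n * ∑ m ∈ A u, ‖z m u‖ ^ 2 := Finset.sum_le_sum fun u _ => by
        calc ‖∑ m ∈ A u, z m u‖ ^ 2 ≤ (∑ m ∈ A u, ‖z m u‖) ^ 2 := by
              gcongr
              exact norm_sum_le _ _
          _ ≤ (A u).card * ∑ m ∈ A u, ‖z m u‖ ^ 2 := sq_sum_le_card_mul_sum_sq
          _ ≤ n * ∑ m ∈ A u, ‖z m u‖ ^ 2 := by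
              gcongr
              exact hA u
    _ ≤ ∑ u ∈ s, n * ∑ m ∈ s.biUnion A, ‖z m u‖ ^ 2 := by
        refine Finset.sum_le_sum fun u hu => ?_
        gcongr
        exact Finset.subset_biUnion_of_mem A hu
    _ = n * ∑ m ∈ s.biUnion A, ∑ u ∈ s, ‖z m u‖ ^ 2 := by
        rw [← Finset.mul_sum, Finset.sum_comm]
    _ ≤ n * ∑ m ∈ s.biUnion A, ‖T‖ ^ 2 * ‖restrict {w | m ∈ B w} x‖ ^ 2 := by
        gcongr with m
        refine (sum_norm_sq_le (z m) s).trans ?_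
        rw [← mul_pow]
        gcongr
        exact T.le_opNorm _
    _ ≤ n * (‖T‖ ^ 2 * (n * ‖x‖ ^ 2)) := by
        rw [← Finset.mul_sum]
        gcongr
        exact sum_norm_sq_restrict_le x B hB _
    _ = (n * ‖T‖ * ‖x‖) ^ 2 := by ring

/-- The block Schur multiplier `∑ m, P_m T Q_m`, where `P_m` and `Q_m` are the projections onto the
spans of the basis vectors `ξ_u` with `m ∈ A u` and `m ∈ B u`, respectively. -/
theorem exists_blockSchur (T : FockSpace S →L[ℂ] FockSpace S) (A B : S → Finset ℕ) {n : ℕ}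
    (hA : ∀ w, (A w).card ≤ n) (hB : ∀ w, (B w).card ≤ n) :
    ∃ G : FockSpace S →L[ℂ] FockSpace S, ‖G‖ ≤ n * ‖T‖ ∧
      ∀ w u, G (fockBasis w) u = (A u ∩ B w).card * T (fockBasis w) u := by
  classical
  let G₀ : FockSpace S →ₗ[ℂ] FockSpace S :=
    { toFun x := ⟨fun u => ∑ m ∈ A u, T (restrict {w | m ∈ B w} x) u,
        memℓp_of_sum_le (sum_blockSchur_le T A B hA hB x)⟩
      map_add' x y := by
        ext u
        change _ = ∑ m ∈ A u, T (restrict {w | m ∈ B w} x) u +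
          ∑ m ∈ A u, T (restrict {w | m ∈ B w} y) u
        simp [Finset.sum_add_distrib]
      map_smul' c x := by
        ext u
        simp [Finset.mul_sum] }
  refine ⟨G₀.mkContinuous (n * ‖T‖) fun x => norm_le_of_sum_le (by positivity)
    (sum_blockSchur_le T A B hA hB x), LinearMap.mkContinuous_norm_le _ (by positivity) _,
    fun w u => ?_⟩
  change ∑ m ∈ A u, T (restrict {w | m ∈ B w} (fockBasis w)) u = _
  have h : ∀ m, T (restrict {w | m ∈ B w} (fockBasis w)) u =
      if m ∈ B w then T (fockBasis w) u else 0 := by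
    intro m
    rw [restrict_fockBasis]
    by_cases h : m ∈ B w <;> simp [h]
  simp only [h]
  rw [← Finset.sum_filter, Finset.sum_const, nsmul_eq_mul, Finset.filter_mem_eq_inter]

end FockSpace

/-! ### The analytic Toeplitz algebra is the commutant of the right shifts -/

namespace FockSpace

section WOT

variable {H : Type*} [NormedAddCommGroup H] [InnerProductSpace ℂ H] [CompleteSpace H]

/-- The matrix coefficients of both `Y T` and `T Y` are WOT-continuous in `T`, the former after
moving `Y` to the other side as its adjoint. -/
theorem isWOTClosed_centralizer (Y : H →L[ℂ] H) :
    IsWOTClosed (Subalgebra.centralizer ℂ ({Y} : Set (H →L[ℂ] H))) := by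
  have h : {T : H →WOT[ℂ] H | T.toCLM ∈ Subalgebra.centralizer ℂ ({Y} : Set (H →L[ℂ] H))} =
      ⋂ (x : H) (y : H), {T : H →WOT[ℂ] H |
        ⟪ContinuousLinearMap.adjoint Y y, T x⟫_ℂ = ⟪y, T (Y x)⟫_ℂ} := by
    ext T
    simp only [Set.mem_ofPred_eq, Subalgebra.mem_centralizer_iff, Set.mem_singleton_iff,
      forall_eq, Set.mem_iInter, ContinuousLinearMap.adjoint_inner_left]
    constructor
    · intro h x y
      have := congrArg (fun Z : H →L[ℂ] H => ⟪y, Z x⟫_ℂ) h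
      simpa using this
    · intro h
      ext x
      exact ext_inner_left ℂ fun y => by simpa using h x y
  rw [IsWOTClosed, h]
  exact isClosed_iInter fun x => isClosed_iInter fun y => isClosed_eq (by fun_prop) (by fun_prop)

end WOT

variable {S : Type*}

/-- An ε/2 argument: finite combinations of basis vectors are dense, and the uniform bound controls
the remainder. -/
theorem tendsto_of_bounded {h : ℕ → FockSpace S →L[ℂ] ℂ} {C : ℝ} (hC : ∀ n, ‖h n‖ ≤ C)
    (h0 : ∀ w, Filter.Tendsto (fun n => h n (fockBasis w)) Filter.atTop (nhds 0))
    (x : FockSpace S) : Filter.Tendsto (fun n => h n x) Filter.atTop (nhds 0) := by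
  have hC0 : 0 ≤ C := (norm_nonneg _).trans (hC 0)
  have hfin : ∀ s : Finset S, Filter.Tendsto (fun n => h n (∑ w ∈ s, x w • fockBasis w))
      Filter.atTop (nhds 0) := by
    intro s
    simp only [map_sum, map_smul]
    simpa using tendsto_finsetSum s fun w _ => (h0 w).const_smul (x w)
  rw [Metric.tendsto_atTop]
  intro ε hε
  have hδ : 0 < ε / (2 * (C + 1)) := by positivity
  obtain ⟨s, hs⟩ := ((Metric.tendsto_nhds.1 (hasSum_fockBasis x)) _ hδ).exists
  obtain ⟨N, hN⟩ := Metric.tendsto_atTop.1 (hfin s) (ε / 2) (by positivity)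
  refine ⟨N, fun n hn => ?_⟩
  have h1 := hN n hn
  rw [dist_zero_right] at h1 ⊢
  set y := ∑ w ∈ s, x w • fockBasis w
  have h2 : ‖h n (x - y)‖ ≤ ε / 2 := by
    rw [dist_comm, dist_eq_norm] at hs
    calc ‖h n (x - y)‖ ≤ C * ‖x - y‖ := (h n).le_of_opNorm_le (hC n) _
      _ ≤ (C + 1) * (ε / (2 * (C + 1))) := by gcongr; linarith
      _ = ε / 2 := by field_simp
  calc ‖h n x‖ = ‖h n (x - y) + h n y‖ := by rw [← map_add]; simp
    _ ≤ ‖h n (x - y)‖ + ‖h n y‖ := norm_add_le _ _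
    _ < ε := by linarith

theorem tendsto_inner_of_bounded {F : ℕ → FockSpace S →L[ℂ] FockSpace S} {C : ℝ}
    {T : FockSpace S →L[ℂ] FockSpace S} (hC : ∀ n, ‖F n‖ ≤ C)
    (h0 : ∀ w u, Filter.Tendsto (fun n => F n (fockBasis w) u) Filter.atTop
      (nhds (T (fockBasis w) u))) (x y : FockSpace S) :
    Filter.Tendsto (fun n => ⟪y, F n x⟫_ℂ) Filter.atTop (nhds ⟪y, T x⟫_ℂ) := by
  have hD : ∀ n, ‖F n - T‖ ≤ C + ‖T‖ := fun n => (norm_sub_le _ _).trans (by linarith [hC n])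
  have h1 : ∀ u, Filter.Tendsto (fun n => (F n - T) x u) Filter.atTop (nhds 0) := by
    intro u
    have := tendsto_of_bounded (h := fun n => coord u ∘L (F n - T)) (C := C + ‖T‖) (fun n => by
      refine (ContinuousLinearMap.opNorm_comp_le _ _).trans ?_
      rw [coord, innerSL_apply_norm, norm_fockBasis, one_mul]
      exact hD n) (fun w => by
        simpa [coord_apply] using (h0 w u).sub_const (T (fockBasis w) u)) x
    simpa [coord_apply] using this
  -- The same principle again, now in the other slot of the inner product, with the coordinates of
  -- `(F n - T) x` as input.
  have h2 := tendsto_of_bounded (h := fun n => innerSL ℂ ((F n - T) x))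
    (C := (C + ‖T‖) * ‖x‖) (fun n => by
      rw [innerSL_apply_norm]
      exact (F n - T).le_of_opNorm_le (hD n) x) (fun u => by
        have h := (Complex.continuous_conj.tendsto 0).comp (h1 u)
        rw [map_zero] at h
        exact h.congr fun n => (inner_fockBasis_right u _).symm) y
  have h3 := ((Complex.continuous_conj.tendsto 0).comp h2).add_const ⟪y, T x⟫_ℂ
  refine Filter.Tendsto.congr (fun n => ?_) (by simpa using h3)
  simp

/-- The canonical unitary from the Fock space of a semigroup to that of its opposite. -/
def opUnitary (S : Type*) : FockSpace S ≃ₗᵢ[ℂ] FockSpace Sᵐᵒᵖ :=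
  LinearIsometryEquiv.ofSurjective (basisMap MulOpposite.op MulOpposite.op_injective) fun y =>
    ⟨basisMap MulOpposite.unop MulOpposite.unop_injective y, by
      ext w
      obtain ⟨w, rfl⟩ := MulOpposite.op_surjective w
      rw [basisMap_apply MulOpposite.op]
      exact basisMap_apply MulOpposite.unop MulOpposite.unop_injective y (MulOpposite.op w)⟩

theorem opUnitary_fockBasis (w : S) :
    opUnitary S (fockBasis w) = fockBasis (MulOpposite.op w) :=
  basisMap_fockBasis _ MulOpposite.op_injective w

theorem opUnitary_symm_fockBasis (w : S) :
    (opUnitary S).symm (fockBasis (MulOpposite.op w)) = fockBasis w := by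
  rw [LinearIsometryEquiv.symm_apply_eq, opUnitary_fockBasis]

variable [Monoid S] [IsCancelMul S]

theorem lShift_mem (v : S) : lShift v ∈ analyticToeplitz S :=
  Algebra.mem_sInf.2 fun _ hA => hA.1 v

theorem isWOTClosed_analyticToeplitz : IsWOTClosed (analyticToeplitz S) := by
  have h : {T : FockSpace S →WOT[ℂ] FockSpace S | T.toCLM ∈ analyticToeplitz S} =
      ⋂ A ∈ {A : Subalgebra ℂ (FockSpace S →L[ℂ] FockSpace S) |
        (∀ v : S, (leftShift v).toContinuousLinearMap ∈ A) ∧ IsWOTClosed A},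
        {T : FockSpace S →WOT[ℂ] FockSpace S | T.toCLM ∈ A} := by
    ext T
    simp [analyticToeplitz, Algebra.mem_sInf]
  rw [IsWOTClosed, h]
  exact isClosed_biInter fun A hA => hA.2

/-- The centralizer of `Y` is one of the WOT-closed algebras whose intersection defines `𝔏_S`. -/
theorem commute_of_mem {T Y : FockSpace S →L[ℂ] FockSpace S} (hT : T ∈ analyticToeplitz S)
    (hY : ∀ v, Commute (lShift v) Y) : Commute T Y := by
  have h := Algebra.mem_sInf.1 hT (Subalgebra.centralizer ℂ {Y})
    ⟨fun v => Subalgebra.mem_centralizer_iff _ |>.2 fun Z hZ => by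
      rw [Set.mem_singleton_iff.1 hZ]; exact (hY v).eq.symm, isWOTClosed_centralizer Y⟩
  exact ((Subalgebra.mem_centralizer_iff _).1 h Y rfl).symm

theorem mem_commutant_iff {T : FockSpace S →L[ℂ] FockSpace S} :
    T ∈ commutant (analyticToeplitz S) ↔ ∀ v, Commute (lShift v) T :=
  ⟨fun h v => (Subalgebra.mem_centralizer_iff _).1 h _ (lShift_mem v),
    fun h => (Subalgebra.mem_centralizer_iff _).2 fun _ hX => commute_of_mem hX h⟩

/-- The coefficients of an operator: its Fourier series is `∑ w, coef T w • L_w`. -/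
def coef (T : FockSpace S →L[ℂ] FockSpace S) (w : S) : ℂ := T (fockBasis 1) w

theorem apply_fockBasis_mul {T : FockSpace S →L[ℂ] FockSpace S} (hT : ∀ v, Commute T (rShift v))
    (v w : S) : T (fockBasis w) (v * w) = coef T v := by
  have h := congrArg (fun Z : FockSpace S →L[ℂ] FockSpace S => Z (fockBasis 1)) (hT w).eq
  simp only [mul_apply_eq_comp, rShift_fockBasis, one_mul] at h
  rw [h, rShift_apply_mul, coef]

theorem apply_fockBasis_eq_zero {T : FockSpace S →L[ℂ] FockSpace S}
    (hT : ∀ v, Commute T (rShift v)) {u w : S} (h : ∀ v, v * w ≠ u) : T (fockBasis w) u = 0 := by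
  have h1 := congrArg (fun Z : FockSpace S →L[ℂ] FockSpace S => Z (fockBasis 1)) (hT w).eq
  simp only [mul_apply_eq_comp, rShift_fockBasis, one_mul] at h1
  rw [h1, rShift_apply_eq_zero w _ h]

/-- The Toeplitz form of the matrix; it lets Schur multipliers be checked for commutation entry by
entry. -/
theorem commute_rShift_iff {T : FockSpace S →L[ℂ] FockSpace S} :
    (∀ v, Commute T (rShift v)) ↔ (∀ v w, T (fockBasis w) (v * w) = coef T v) ∧
      ∀ u w, (∀ v, v * w ≠ u) → T (fockBasis w) u = 0 := by
  refine ⟨fun h => ⟨apply_fockBasis_mul h, fun u w => apply_fockBasis_eq_zero h⟩,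
    fun ⟨h1, h2⟩ r => ?_⟩
  refine clm_ext_apply fun w u => ?_
  simp only [mul_apply_eq_comp, rShift_fockBasis]
  by_cases hu : ∃ t, t * r = u
  · obtain ⟨t, rfl⟩ := hu
    rw [rShift_apply_mul]
    by_cases ht : ∃ v, v * w = t
    · obtain ⟨v, rfl⟩ := ht
      rw [mul_assoc, h1, h1]
    · push Not at ht
      rw [h2 t w ht, h2 _ _ fun v hv => ht v (mul_right_cancel (b := r) (by rw [mul_assoc, hv]))]
  · push Not at hu
    rw [rShift_apply_eq_zero r _ hu, h2 _ _ fun v hv => hu (v * w) (by rw [mul_assoc, hv])]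

theorem eq_of_coef_eq {T T' : FockSpace S →L[ℂ] FockSpace S} (hT : ∀ v, Commute T (rShift v))
    (hT' : ∀ v, Commute T' (rShift v)) (h : ∀ v, coef T v = coef T' v) : T = T' := by
  refine clm_ext_apply fun w u => ?_
  by_cases hu : ∃ v, v * w = u
  · obtain ⟨v, rfl⟩ := hu
    rw [apply_fockBasis_mul hT, apply_fockBasis_mul hT', h]
  · push Not at hu
    rw [apply_fockBasis_eq_zero hT hu, apply_fockBasis_eq_zero hT' hu]

theorem card_Ico_inter (a b n : ℕ) :
    (Finset.Ico (a + b) (a + b + n) ∩ Finset.Ico b (b + n)).card = n - a := by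
  rw [Finset.Ico_inter_Ico, Nat.card_Ico]
  omega

theorem lShift_commute_rShift (v w : S) : Commute (lShift v) (rShift w) := lShift_mul_rShift v w

/-- If the fibres of a degree function are finite, then every operator which commutes with the right
shifts is the limit of its Cesàro means, which are polynomials in the left shifts. -/
theorem mem_analyticToeplitz_of_commute (d : S → ℕ) (hd : ∀ v w, d (v * w) = d v + d w)
    (hfin : ∀ n, {w | d w = n}.Finite) {T : FockSpace S →L[ℂ] FockSpace S}
    (hT : ∀ v, Commute T (rShift v)) : T ∈ analyticToeplitz S := by
  -- Two windows of length `n` starting at `d (v * w)` and `d w` share `n - d v` integers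
  -- (truncated), so `G` is `n` times the Fejér mean.
  have hG : ∀ n : ℕ, ∃ G : FockSpace S →L[ℂ] FockSpace S, ‖G‖ ≤ n * ‖T‖ ∧
      ∀ w u, G (fockBasis w) u = (Finset.Ico (d u) (d u + n) ∩ Finset.Ico (d w) (d w + n)).card *
        T (fockBasis w) u := fun n =>
    exists_blockSchur T _ _ (fun w => by simp) fun w => by simp
  choose G hGn hGe using hG
  have hcard : ∀ n v w, G n (fockBasis w) (v * w) = (n - d v : ℕ) * coef T v := by
    intro n v w
    rw [hGe, hd, card_Ico_inter, apply_fockBasis_mul hT]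
  have hcoef : ∀ n v, coef (G n) v = (n - d v : ℕ) * coef T v := fun n v => by
    simpa [coef] using hcard n v 1
  have hGc : ∀ n v, Commute (G n) (rShift v) := fun n =>
    commute_rShift_iff.2 ⟨fun v w => by rw [hcard, hcoef], fun u w h => by
      rw [hGe, apply_fockBasis_eq_zero hT h, mul_zero]⟩
  have hlt : ∀ n, {w | d w < n}.Finite := fun n => by
    have : {w | d w < n} = ⋃ k ∈ Finset.range n, {w | d w = k} := by ext; simp
    rw [this]
    exact Set.Finite.biUnion (Finset.finite_toSet _) fun k _ => hfin k
  have hmem : ∀ n, G n ∈ analyticToeplitz S := by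
    intro n
    -- The truncated weight `n - d v` kills all coefficients of degree at least `n`, leaving
    -- finitely many.
    have : G n = ∑ w ∈ (hlt n).toFinset, coef (G n) w • lShift w := by
      refine eq_of_coef_eq (hGc n) (fun v => Commute.sum_left _ _ _ fun w _ =>
        (lShift_commute_rShift w v).smul_left _) fun v => ?_
      rw [coef.eq_1 (∑ w ∈ _, _)]
      simp only [sum_apply, smul_apply, lShift_fockBasis,
        mul_one, lp.coeFn_sum, Finset.sum_apply, lp.coeFn_smul, Pi.smul_apply, smul_eq_mul]
      rw [Finset.sum_eq_single v]
      · simp [fockBasis_apply_self]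
      · intro w _ hw
        simp [fockBasis_apply_ne hw.symm]
      · intro hv
        have : n ≤ d v := by simpa using hv
        rw [hcoef, Nat.sub_eq_zero_of_le this]
        simp
    rw [this]
    exact Subalgebra.sum_mem _ fun w _ => Subalgebra.smul_mem _ (lShift_mem w) _
  set F : ℕ → FockSpace S →L[ℂ] FockSpace S := fun n => ((n + 1 : ℕ) : ℂ)⁻¹ • G (n + 1)
  have hF : ∀ n, F n ∈ analyticToeplitz S := fun n => Subalgebra.smul_mem _ (hmem _) _
  have hFn : ∀ n, ‖F n‖ ≤ ‖T‖ := by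
    intro n
    rw [norm_smul, norm_inv, Complex.norm_natCast, inv_mul_le_iff₀ (by positivity)]
    exact hGn _
  have hFe : ∀ w u, Filter.Tendsto (fun n => F n (fockBasis w) u) Filter.atTop
      (nhds (T (fockBasis w) u)) := by
    intro w u
    by_cases hu : ∃ v, v * w = u
    · obtain ⟨v, rfl⟩ := hu
      rw [apply_fockBasis_mul hT]
      have h1 : Filter.Tendsto (fun n : ℕ => 1 - (d v : ℂ) * ((n : ℂ) + 1)⁻¹) Filter.atTop
          (nhds 1) := by
        have h2 : Filter.Tendsto (fun n : ℕ => ((n : ℂ) + 1)⁻¹) Filter.atTop (nhds 0) := by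
          simpa using tendsto_one_div_add_atTop_nhds_zero_nat (𝕜 := ℂ)
        simpa using (h2.const_mul (d v : ℂ)).const_sub 1
      have h3 := h1.mul_const (coef T v)
      rw [one_mul] at h3
      refine h3.congr' ?_
      filter_upwards [Filter.eventually_ge_atTop (d v)] with n hn
      have h4 : F n (fockBasis w) (v * w) =
        ((n + 1 : ℕ) : ℂ)⁻¹ * G (n + 1) (fockBasis w) (v * w) := rfl
      have h5 : (n : ℂ) + 1 ≠ 0 := Nat.cast_add_one_ne_zero n
      rw [h4, hcard, Nat.cast_sub (by omega)]
      push_cast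
      field_simp
    · push Not at hu
      have h4 : ∀ n, F n (fockBasis w) u = 0 := fun n => by
        have : F n (fockBasis w) u = ((n + 1 : ℕ) : ℂ)⁻¹ * G (n + 1) (fockBasis w) u := rfl
        rw [this, apply_fockBasis_eq_zero (hGc _) hu, mul_zero]
      simp [h4, apply_fockBasis_eq_zero hT hu]
  have hlim : Filter.Tendsto (fun n => ContinuousLinearMapWOT.ofCLM (F n)) Filter.atTop
      (nhds (ContinuousLinearMapWOT.ofCLM T)) :=
    ContinuousLinearMapWOT.tendsto_iff_forall_inner_apply_tendsto.2
      (tendsto_inner_of_bounded hFn hFe)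
  exact isWOTClosed_analyticToeplitz.mem_of_tendsto hlim (Filter.Eventually.of_forall hF)

theorem mem_analyticToeplitz_iff (d : S → ℕ) (hd : ∀ v w, d (v * w) = d v + d w)
    (hfin : ∀ n, {w | d w = n}.Finite) {T : FockSpace S →L[ℂ] FockSpace S} :
    T ∈ analyticToeplitz S ↔ ∀ v, Commute T (rShift v) :=
  ⟨fun h v => commute_of_mem h fun w => lShift_commute_rShift w v,
    mem_analyticToeplitz_of_commute d hd hfin⟩

/-! ### The commutant -/

theorem mem_commutant_iff_conj_mem (d : S → ℕ) (hd : ∀ v w, d (v * w) = d v + d w)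
    (hfin : ∀ n, {w | d w = n}.Finite) (T : FockSpace S →L[ℂ] FockSpace S) :
    T ∈ commutant (analyticToeplitz S) ↔
      (opUnitary S : FockSpace S →L[ℂ] FockSpace Sᵐᵒᵖ) ∘L T ∘L
        ((opUnitary S).symm : FockSpace Sᵐᵒᵖ →L[ℂ] FockSpace S) ∈ analyticToeplitz Sᵐᵒᵖ := by
  have hfin' : ∀ n, {w : Sᵐᵒᵖ | d w.unop = n}.Finite := fun n =>
    (hfin n).preimage MulOpposite.unop_injective.injOn
  rw [mem_analyticToeplitz_iff (S := Sᵐᵒᵖ) (fun w => d w.unop)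
    (fun v w => by rw [MulOpposite.unop_mul, hd, add_comm]) hfin', mem_commutant_iff,
    MulOpposite.op_surjective.forall]
  refine forall_congr' fun v => ?_
  -- Right multiplication in the opposite semigroup is left multiplication in `S`, so the two
  -- commutation conditions are unitarily equivalent.
  have hR : ∀ y, rShift (MulOpposite.op v) y = opUnitary S (lShift v ((opUnitary S).symm y)) := by
    intro y
    have : rShift (MulOpposite.op v) = (opUnitary S : FockSpace S →L[ℂ] FockSpace Sᵐᵒᵖ) ∘L
        lShift v ∘L ((opUnitary S).symm : FockSpace Sᵐᵒᵖ →L[ℂ] FockSpace S) := by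
      refine clm_ext fun w => ?_
      obtain ⟨w, rfl⟩ := MulOpposite.op_surjective w
      simp [opUnitary_fockBasis, opUnitary_symm_fockBasis]
    rw [this]
    rfl
  constructor
  · intro h
    ext1 y
    have := congrArg (fun Z : FockSpace S →L[ℂ] FockSpace S => Z ((opUnitary S).symm y)) h.eq
    simp only [mul_apply_eq_comp] at this
    simp [hR, this]
  · intro h
    ext1 x
    have := congrArg (fun Z : FockSpace Sᵐᵒᵖ →L[ℂ] FockSpace Sᵐᵒᵖ => Z (opUnitary S x)) h.eq
    simp only [mul_apply_eq_comp, hR] at this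
    simpa using this.symm

end FockSpace

/-! ### Operators in the commutant of the right shifts: homogeneous parts and division by letters -/

namespace FockSpace

variable {S : Type*} [Monoid S]

theorem coef_sub (T T' : FockSpace S →L[ℂ] FockSpace S) (v : S) :
    coef (T - T') v = coef T v - coef T' v := rfl

theorem coef_smul (c : ℂ) (T : FockSpace S →L[ℂ] FockSpace S) (v : S) :
    coef (c • T) v = c * coef T v := rfl

theorem coef_sum {ι : Type*} (s : Finset ι) (T : ι → FockSpace S →L[ℂ] FockSpace S) (v : S) :
    coef (∑ i ∈ s, T i) v = ∑ i ∈ s, coef (T i) v := by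
  simp only [coef, sum_apply, lp.coeFn_sum, Finset.sum_apply]

theorem coef_one (v : S) : coef (1 : FockSpace S →L[ℂ] FockSpace S) v = fockBasis 1 v := rfl

theorem norm_coef_le (T : FockSpace S →L[ℂ] FockSpace S) (v : S) : ‖coef T v‖ ≤ ‖T‖ := by
  refine (norm_apply_le _ v).trans ?_
  simpa [norm_fockBasis] using T.le_opNorm (fockBasis 1)

variable [IsCancelMul S]

/-- The homogeneous part of degree `l` of an operator in the commutant of the right shifts. -/
theorem exists_homogeneousPart (d : S → ℕ) (hd : ∀ v w, d (v * w) = d v + d w) (l : ℕ)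
    {T : FockSpace S →L[ℂ] FockSpace S} (hT : ∀ v, Commute T (rShift v)) :
    ∃ G : FockSpace S →L[ℂ] FockSpace S, ‖G‖ ≤ ‖T‖ ∧ (∀ v, Commute G (rShift v)) ∧
      ∀ v, coef G v = if d v = l then coef T v else 0 := by
  -- This keeps only the entries with `d u = d w + l`; the case split avoids truncated subtraction.
  -- Singleton blocks give the bound with constant `1`.
  obtain ⟨G, hG, hGe⟩ := exists_blockSchur T (fun u => if l ≤ d u then {d u - l} else ∅)
    (fun w => {d w}) (n := 1) (fun w => by split_ifs <;> simp) (fun w => by simp)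
  have hcard : ∀ v w, G (fockBasis w) (v * w) = if d v = l then coef T v else 0 := by
    intro v w
    rw [hGe, hd, apply_fockBasis_mul hT]
    by_cases h : d v = l
    · simp [h]
    · rw [if_neg h]
      have : ((if l ≤ d v + d w then ({d v + d w - l} : Finset ℕ) else ∅) ∩ {d w}) = ∅ := by
        split_ifs with h1
        · rw [← Finset.disjoint_iff_inter_eq_empty, Finset.disjoint_singleton]
          omega
        · simp
      simp [this]
  have hcoef : ∀ v, coef G v = if d v = l then coef T v else 0 := fun v => by
    simpa [coef] using hcard v 1
  refine ⟨G, by simpa using hG, commute_rShift_iff.2 ⟨fun v w => by rw [hcard, hcoef],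
    fun u w h => by rw [hGe, apply_fockBasis_eq_zero hT h, mul_zero]⟩, hcoef⟩

theorem coef_lShiftAdj_mul (s : S) (T : FockSpace S →L[ℂ] FockSpace S) (v : S) :
    coef (lShiftAdj (s) * T) v = coef T (s * v) := by
  rw [coef, mul_apply_eq_comp, lShiftAdj_apply, coef]

/-- The family `g` is the set of letters for the degree function `d`: every element of positive
degree can be divided from the left by exactly one letter. -/
structure IsLetters {ι : Type*} (g : ι → S) (d : S → ℕ) : Prop where
  map_mul : ∀ v w, d (v * w) = d v + d w
  map_letter : ∀ i, d (g i) = 1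
  exists_mul_eq : ∀ s, d s ≠ 0 → ∃ i u, g i * u = s
  eq_of_mul_eq : ∀ i k u u', g i * u = g k * u' → i = k

namespace IsLetters

variable {ι : Type*} {g : ι → S} {d : S → ℕ}

theorem lShiftAdj_mul_lShift_of_ne (hg : IsLetters g d) {i k : ι} (h : i ≠ k) :
    lShiftAdj (g i) * lShift (g k) = 0 := by
  refine clm_ext_apply fun w u => ?_
  rw [mul_apply_eq_comp, lShiftAdj_apply, lShift_apply_eq_zero]
  · rfl
  · exact fun t ht => h (hg.eq_of_mul_eq _ _ _ _ ht).symm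

/-- If `v * w = g i * u` and `v` has positive degree, the letter `g i` comes off `v` and leaves `w`
intact. Only for `v` of degree zero could it come from `w`, and those coefficients vanish. -/
theorem commute_lShiftAdj_mul (hg : IsLetters g d) (i : ι) {T : FockSpace S →L[ℂ] FockSpace S}
    (hT : ∀ v, Commute T (rShift v)) (h0 : ∀ v, d v = 0 → coef T v = 0) (v : S) :
    Commute (lShiftAdj (g i) * T) (rShift v) := by
  revert v
  refine commute_rShift_iff.2 ⟨fun v w => ?_, fun u w h => ?_⟩
  · rw [mul_apply_eq_comp, lShiftAdj_apply, coef, mul_apply_eq_comp, lShiftAdj_apply, ← mul_assoc,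
      apply_fockBasis_mul hT, coef]
  · rw [mul_apply_eq_comp, lShiftAdj_apply]
    by_cases hv : ∃ v, v * w = g i * u
    · obtain ⟨v, hv⟩ := hv
      rw [← hv, apply_fockBasis_mul hT]
      refine h0 v ?_
      by_contra hd
      obtain ⟨k, t, rfl⟩ := hg.exists_mul_eq v hd
      rw [mul_assoc] at hv
      obtain rfl := hg.eq_of_mul_eq _ _ _ _ hv
      exact h t (mul_left_cancel hv)
    · push Not at hv
      exact apply_fockBasis_eq_zero hT hv

variable [Fintype ι]

/-- The sum of the `L_{g i} L_{g i}^*` is the projection onto the elements divisible by a letter,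
and `T` maps into its range since it has no part of degree zero. -/
theorem sum_lShift_mul (hg : IsLetters g d) {T : FockSpace S →L[ℂ] FockSpace S}
    (hT : ∀ v, Commute T (rShift v)) (h0 : ∀ v, d v = 0 → coef T v = 0) :
    ∑ i, lShift (g i) * (lShiftAdj (g i) * T) = T := by
  refine clm_ext_apply fun w u => ?_
  simp only [sum_apply, mul_apply_eq_comp, lp.coeFn_sum, Finset.sum_apply]
  by_cases hu : ∃ i t, g i * t = u
  · obtain ⟨i, t, rfl⟩ := hu
    rw [Finset.sum_eq_single i]
    · simp
    · intro k _ hk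
      exact lShift_apply_eq_zero _ _ fun t' ht' => hk (hg.eq_of_mul_eq _ _ _ _ ht')
    · simp
  · push Not at hu
    rw [Finset.sum_eq_zero fun i _ => lShift_apply_eq_zero _ _ (hu i)]
    by_cases hv : ∃ v, v * w = u
    · obtain ⟨v, rfl⟩ := hv
      rw [apply_fockBasis_mul hT, h0]
      by_contra hd
      obtain ⟨k, t, rfl⟩ := hg.exists_mul_eq v hd
      exact hu k (t * w) (mul_assoc _ _ _).symm
    · push Not at hv
      rw [apply_fockBasis_eq_zero hT hv]

theorem norm_sum_smul_lShift_apply (hg : IsLetters g d) (c : ι → ℂ) (x : FockSpace S) :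
    ‖∑ i, c i • lShift (g i) x‖ ^ 2 = (∑ i, ‖c i‖ ^ 2) * ‖x‖ ^ 2 := by
  classical
  have h : ∀ i k, ⟪lShift (g i) x, lShift (g k) x⟫_ℂ = if i = k then (‖x‖ : ℂ) ^ 2 else 0 := by
    intro i k
    split_ifs with h
    · subst h
      rw [inner_self_eq_norm_sq_to_K, norm_lShift_apply]
      rfl
    · rw [← ContinuousLinearMap.adjoint_inner_right]
      have := congrArg (fun Z : FockSpace S →L[ℂ] FockSpace S => Z x)
        (hg.lShiftAdj_mul_lShift_of_ne h)
      simp only [mul_apply_eq_comp, lShiftAdj] at this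
      rw [this]
      simp
  have h2 : ((‖∑ i, c i • lShift (g i) x‖ : ℂ)) ^ 2 = (∑ i, (‖c i‖ : ℂ) ^ 2) * (‖x‖ : ℂ) ^ 2 := by
    have := inner_self_eq_norm_sq_to_K (𝕜 := ℂ) (∑ i, c i • lShift (g i) x)
    refine Eq.trans this.symm ?_
    simp only [sum_inner, inner_sum, inner_smul_left, inner_smul_right, h, mul_ite, mul_zero,
      Finset.sum_ite_eq', Finset.mem_univ, if_true, Finset.sum_mul]
    refine Finset.sum_congr rfl fun i _ => ?_
    rw [← mul_assoc]
    congr 1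
    exact Complex.mul_conj' _
  exact_mod_cast h2

theorem norm_sum_smul_lShift_le (hg : IsLetters g d) (c : ι → ℂ) :
    ‖∑ i, c i • lShift (g i)‖ ≤ √(∑ i, ‖c i‖ ^ 2) := by
  refine ContinuousLinearMap.opNorm_le_bound _ (Real.sqrt_nonneg _) fun x => ?_
  refine le_of_sq_le_sq ?_ (by positivity)
  rw [mul_pow, Real.sq_sqrt (Finset.sum_nonneg fun i _ => by positivity),
    ← hg.norm_sum_smul_lShift_apply]
  simp

theorem norm_sum_smul_lShiftAdj_le (hg : IsLetters g d) (c : ι → ℂ) :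
    ‖∑ i, c i • lShiftAdj (g i)‖ ≤ √(∑ i, ‖c i‖ ^ 2) := by
  have h : ∑ i, c i • lShiftAdj (g i) =
      ContinuousLinearMap.adjoint (∑ i, (starRingEnd ℂ (c i)) • lShift (g i)) := by
    simp [lShiftAdj, map_smulₛₗ]
  rw [h, LinearIsometryEquiv.norm_map]
  simpa using hg.norm_sum_smul_lShift_le fun i => starRingEnd ℂ (c i)

/-- Division of an operator by the letters, and substitution of numbers for them. -/
theorem exists_substitution (hg : IsLetters g d) (α : ι → ℂ) {T : FockSpace S →L[ℂ] FockSpace S}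
    (hT : ∀ v, Commute T (rShift v)) (h0 : ∀ v, d v = 0 → coef T v = 0)
    (δ : (FockSpace S →L[ℂ] FockSpace S) →ₗ[ℂ] ℂ)
    (hδ : ∀ i X, (∀ v, Commute X (rShift v)) → δ (lShift (g i) * X) = α i * δ X) :
    ∃ X : FockSpace S →L[ℂ] FockSpace S, (∀ v, Commute X (rShift v)) ∧ δ X = δ T ∧
      ‖X‖ ≤ √(∑ i, ‖α i‖ ^ 2) * ‖T‖ ∧ ∀ v, coef X v = ∑ i, α i * coef T (g i * v) := by
  refine ⟨∑ i, α i • (lShiftAdj (g i) * T), fun v => Commute.sum_left _ _ _ fun i _ =>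
    (hg.commute_lShiftAdj_mul i hT h0 v).smul_left _, ?_, ?_, fun v => ?_⟩
  · conv_rhs => rw [← hg.sum_lShift_mul hT h0]
    simp only [map_sum, map_smul, smul_eq_mul]
    exact Finset.sum_congr rfl fun i _ => (hδ i _ (hg.commute_lShiftAdj_mul i hT h0)).symm
  · have : ∑ i, α i • (lShiftAdj (g i) * T) = (∑ i, α i • lShiftAdj (g i)) * T := by
      simp [Finset.sum_mul]
    rw [this]
    refine (norm_mul_le _ _).trans ?_
    gcongr
    exact hg.norm_sum_smul_lShiftAdj_le α
  · simp only [coef_sum, coef_smul, coef_lShiftAdj_mul]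

/-- A bounded functional on the commutant of the right shifts for which the letters act as scalars
of length less than one vanishes if it vanishes on the operators of degree zero. -/
theorem functional_eq_zero (hg : IsLetters g d) (α : ι → ℂ) (hα : ∑ i, ‖α i‖ ^ 2 < 1)
    (δ : (FockSpace S →L[ℂ] FockSpace S) →ₗ[ℂ] ℂ) {C : ℝ}
    (hC : ∀ X, (∀ v, Commute X (rShift v)) → ‖δ X‖ ≤ C * ‖X‖)
    (hδ : ∀ i X, (∀ v, Commute X (rShift v)) → δ (lShift (g i) * X) = α i * δ X)
    (U : Set S) (hU : ∀ i u, g i * u ∈ U → u ∈ U)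
    (h0 : ∀ X, (∀ v, Commute X (rShift v)) → (∀ v, v ∉ U → coef X v = 0) →
      (∀ v, d v ≠ 0 → coef X v = 0) → δ X = 0)
    {T : FockSpace S →L[ℂ] FockSpace S} (hT : ∀ v, Commute T (rShift v))
    (hTU : ∀ v, v ∉ U → coef T v = 0) : δ T = 0 := by
  set r := √(∑ i, ‖α i‖ ^ 2) with hr
  have hr0 : 0 ≤ r := Real.sqrt_nonneg _
  have hr1 : r < 1 := by rw [hr, Real.sqrt_lt' one_pos]; simpa using hα
  have hC0 : 0 ≤ C := by
    have := (norm_nonneg _).trans (hC 1 fun v => Commute.one_left _)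
    rcases subsingleton_or_nontrivial (FockSpace S →L[ℂ] FockSpace S) with h | h
    · have h1 := fockBasis_apply_self (1 : S)
      rw [← lShift_one] at this
      have h2 : lShift (1 : S) (fockBasis 1) 1 = 0 := by
        rw [Subsingleton.elim (lShift (1 : S)) 0]; rfl
      rw [lShift_one] at h2
      exact absurd (h2.symm.trans h1) (by norm_num)
    · simpa using this
  -- Each substitution lowers the degree by one, preserves `δ` and contracts the norm by `r`; it can
  -- be done `k` times.
  have hhigh : ∀ (k : ℕ) (X : FockSpace S →L[ℂ] FockSpace S), (∀ v, Commute X (rShift v)) →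
      (∀ v, d v < k → coef X v = 0) → ‖δ X‖ ≤ C * r ^ k * ‖X‖ := by
    intro k
    induction k with
    | zero => intro X hX _; simpa using hC X hX
    | succ k ih =>
      intro X hX hXk
      obtain ⟨Y, hY, hYδ, hYn, hYc⟩ := hg.exists_substitution α hX
        (fun v hv => hXk v (by omega)) δ hδ
      rw [← hYδ]
      have h1 := ih Y hY fun v hv => by
        rw [hYc]
        refine Finset.sum_eq_zero fun i _ => ?_
        rw [hXk _ (by rw [hg.map_mul, hg.map_letter]; omega), mul_zero]
      calc ‖δ Y‖ ≤ C * r ^ k * ‖Y‖ := h1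
        _ ≤ C * r ^ k * (r * ‖X‖) := by gcongr
        _ = C * r ^ (k + 1) * ‖X‖ := by ring
  have hhom : ∀ (l : ℕ) (X : FockSpace S →L[ℂ] FockSpace S), (∀ v, Commute X (rShift v)) →
      (∀ v, v ∉ U → coef X v = 0) → (∀ v, d v ≠ l → coef X v = 0) → δ X = 0 := by
    intro l
    induction l with
    | zero => exact h0
    | succ l ih =>
      intro X hX hXU hXl
      obtain ⟨Y, hY, hYδ, -, hYc⟩ := hg.exists_substitution α hX
        (fun v hv => hXl v (by omega)) δ hδ
      rw [← hYδ]
      refine ih Y hY (fun v hv => ?_) fun v hv => ?_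
      · rw [hYc]
        refine Finset.sum_eq_zero fun i _ => ?_
        rw [hXU _ fun h => hv (hU i v h), mul_zero]
      · rw [hYc]
        refine Finset.sum_eq_zero fun i _ => ?_
        rw [hXl _ (by rw [hg.map_mul, hg.map_letter]; omega), mul_zero]
  choose G hGn hGc hGe using fun l => exists_homogeneousPart d hg.map_mul l hT
  -- Removing the first `k` homogeneous parts does not change `δ T`. The tail may grow in norm like
  -- `k + 1`, which the geometric decay absorbs.
  have hbound : ∀ k : ℕ, ‖δ T‖ ≤ C * ‖T‖ * ((k : ℝ) * r ^ k + r ^ k) := by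
    intro k
    have h1 : δ T = δ (T - ∑ l ∈ Finset.range k, G l) := by
      rw [map_sub, map_sum, Finset.sum_eq_zero, sub_zero]
      intro l _
      refine hhom l (G l) (hGc l) (fun v hv => ?_) fun v hv => ?_
      · rw [hGe, hTU v hv, ite_self]
      · rw [hGe, if_neg hv]
    have h2 := hhigh k (T - ∑ l ∈ Finset.range k, G l)
      (fun v => (hT v).sub_left (Commute.sum_left _ _ _ fun l _ => hGc l v)) fun v hv => by
        rw [coef_sub, coef_sum, Finset.sum_eq_single (d v)]
        · simp [hGe]
        · intro l _ hl
          rw [hGe, if_neg hl.symm]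
        · simp [hv]
    have h3 : ‖T - ∑ l ∈ Finset.range k, G l‖ ≤ (k + 1) * ‖T‖ := by
      calc ‖T - ∑ l ∈ Finset.range k, G l‖ ≤ ‖T‖ + ‖∑ l ∈ Finset.range k, G l‖ := norm_sub_le _ _
        _ ≤ ‖T‖ + ∑ l ∈ Finset.range k, ‖T‖ := by
          gcongr
          exact (norm_sum_le _ _).trans (Finset.sum_le_sum fun l _ => hGn l)
        _ = (k + 1) * ‖T‖ := by simp; ring
    calc ‖δ T‖ ≤ C * r ^ k * ‖T - ∑ l ∈ Finset.range k, G l‖ := by rw [h1]; exact h2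
      _ ≤ C * r ^ k * ((k + 1) * ‖T‖) := by gcongr
      _ = C * ‖T‖ * ((k : ℝ) * r ^ k + r ^ k) := by ring
  have hlim : Filter.Tendsto (fun k : ℕ => C * ‖T‖ * ((k : ℝ) * r ^ k + r ^ k)) Filter.atTop
      (nhds 0) := by
    simpa using ((tendsto_self_mul_const_pow_of_lt_one hr0 hr1).add
      (tendsto_pow_atTop_nhds_zero_of_lt_one hr0 hr1)).const_mul (C * ‖T‖)
  exact norm_le_zero_iff.1 (ge_of_tendsto' hlim hbound)

end IsLetters

end FockSpace

/-! ### Coefficients of products in the commutant of the left shifts -/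

namespace FockSpace

variable {S : Type*} [Monoid S]

/-- A degree function with a finite set of generators as its elements of degree one. -/
structure IsGraded {κ : Type*} (g : κ → S) (d : S → ℕ) : Prop where
  map_mul : ∀ v w, d (v * w) = d v + d w
  map_gen : ∀ x, d (g x) = 1
  eq_one : ∀ s, d s = 0 → s = 1
  exists_gen : ∀ s, d s = 1 → ∃ x, g x = s
  injective : Function.Injective g

theorem IsGraded.map_one {κ : Type*} {g : κ → S} {d : S → ℕ} (hg : IsGraded g d) :
    d 1 = 0 := by
  have := hg.map_mul 1 1
  rw [mul_one] at this
  omega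

theorem IsGraded.gen_ne_one {κ : Type*} {g : κ → S} {d : S → ℕ} (hg : IsGraded g d) (x : κ) :
    g x ≠ 1 := fun h => by
  have := hg.map_gen x
  rw [h, hg.map_one] at this
  omega

variable [IsCancelMul S]

/-- Expand `b' ξ_1` in the basis and use `b ξ_v = L_v b ξ_1`. The factors thus convolve in reversed
order, as in the opposite semigroup. -/
theorem hasSum_coef_mul {b : FockSpace S →L[ℂ] FockSpace S} (hb : ∀ v, Commute (lShift v) b)
    (b' : FockSpace S →L[ℂ] FockSpace S) (w : S) :
    HasSum (fun v => coef b' v * lShift v (b (fockBasis 1)) w) (coef (b * b') w) := by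
  have h := (coord w ∘L b).hasSum (hasSum_fockBasis (b' (fockBasis 1)))
  simp only [ContinuousLinearMap.comp_apply, map_smul, coord_apply, smul_eq_mul] at h
  have h1 : ∀ v, lShift v (b (fockBasis 1)) = b (fockBasis v) := fun v => by
    simpa using congrArg (fun Z : FockSpace S →L[ℂ] FockSpace S => Z (fockBasis 1)) (hb v).eq
  simp only [h1]
  exact h

theorem coef_mul_eq_sum {b : FockSpace S →L[ℂ] FockSpace S} (hb : ∀ v, Commute (lShift v) b)
    (b' : FockSpace S →L[ℂ] FockSpace S) (w : S) (F : Finset S)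
    (hF : ∀ v, v ∉ F → coef b' v * lShift v (b (fockBasis 1)) w = 0) :
    coef (b * b') w = ∑ v ∈ F, coef b' v * lShift v (b (fockBasis 1)) w :=
  (hasSum_coef_mul hb b' w).unique (hasSum_sum_of_ne_finset_zero hF)

theorem eq_one_of_apply_eq {b : FockSpace S →L[ℂ] FockSpace S} (hb : ∀ v, Commute (lShift v) b)
    (h : b (fockBasis 1) = fockBasis 1) : b = 1 := by
  refine clm_ext fun w => ?_
  have h1 := congrArg (fun Z : FockSpace S →L[ℂ] FockSpace S => Z (fockBasis 1)) (hb w).eq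
  simp only [mul_apply_eq_comp, lShift_fockBasis, mul_one, h] at h1
  exact h1.symm

namespace IsGraded

variable {κ : Type*} {g : κ → S} {d : S → ℕ}

theorem lShift_apply_self (v : S) (x : FockSpace S) : lShift v x v = x 1 := by
  have := lShift_apply_mul v 1 x
  rwa [mul_one] at this

/-- The Leibniz rule: a generator factors only trivially, so its coefficient is a derivation at the
vacuum character. -/
theorem coef_mul_gen (hg : IsGraded g d) {b : FockSpace S →L[ℂ] FockSpace S}
    (hb : ∀ v, Commute (lShift v) b) (b' : FockSpace S →L[ℂ] FockSpace S) (y : κ) :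
    coef (b * b') (g y) = coef b (g y) * coef b' 1 + coef b 1 * coef b' (g y) := by
  classical
  rw [coef_mul_eq_sum hb b' (g y) {1, g y} fun v hv => ?_]
  · rw [Finset.sum_pair (hg.gen_ne_one y).symm, lShift_one, lShift_apply_self]
    simp only [coef, one_apply_eq_self]
    ring
  · rw [lShift_apply_eq_zero, mul_zero]
    intro t ht
    have h1 := hg.map_mul v t
    rw [ht, hg.map_gen] at h1
    simp only [Finset.mem_insert, Finset.mem_singleton, not_or] at hv
    have h2 : d v ≠ 0 := fun h => hv.1 (hg.eq_one v h)
    have h3 := hg.eq_one t (by omega)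
    rw [h3, mul_one] at ht
    exact hv.2 ht

open Classical in
theorem coef_mul_of_two (hg : IsGraded g d) [Fintype κ] {b b' : FockSpace S →L[ℂ] FockSpace S}
    (hb : ∀ v, Commute (lShift v) b) (h1 : coef b 1 = 0) (h1' : coef b' 1 = 0) {w : S}
    (hw : d w = 2) :
    coef (b * b') w = ∑ x, ∑ y, if g x * g y = w then coef b' (g x) * coef b (g y) else 0 := by
  rw [coef_mul_eq_sum hb b' w (Finset.univ.image g) fun v hv => ?_]
  · rw [Finset.sum_image hg.injective.injOn]
    refine Finset.sum_congr rfl fun x _ => ?_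
    by_cases hx : ∃ t, g x * t = w
    · obtain ⟨t, rfl⟩ := hx
      have h2 := hg.map_mul (g x) t
      rw [hw, hg.map_gen] at h2
      obtain ⟨y, rfl⟩ := hg.exists_gen t (by omega)
      rw [lShift_apply_mul, Finset.sum_eq_single y]
      · simp [coef]
      · intro z _ hz
        rw [if_neg fun h => hz (hg.injective (mul_left_cancel h))]
      · simp
    · push Not at hx
      rw [lShift_apply_eq_zero _ _ hx, mul_zero]
      exact (Finset.sum_eq_zero fun y _ => if_neg (hx _)).symm
  · simp only [Finset.mem_image, Finset.mem_univ, true_and, not_exists] at hv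
    by_cases hv1 : v = 1
    · rw [hv1, h1', zero_mul]
    by_cases ht : ∃ t, v * t = w
    · obtain ⟨t, rfl⟩ := ht
      rw [hg.map_mul] at hw
      have h2 : d v ≠ 0 := fun h => hv1 (hg.eq_one v h)
      have h3 : d v ≠ 1 := fun h => by
        obtain ⟨x, hx⟩ := hg.exists_gen v h
        exact hv x hx
      rw [hg.eq_one t (by omega), lShift_apply_mul]
      rw [coef] at h1
      rw [h1, mul_zero]
    · push Not at ht
      rw [lShift_apply_eq_zero _ _ ht, mul_zero]

end IsGraded

end FockSpace

/-! ### Degrees and letters in a 2-graph -/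

namespace TwoGraph

variable {n m : ℕ} (θ : Equiv.Perm (Fin n × Fin m))

/-- The generators of the semigroup of a 2-graph. -/
def gen (x : Fin n ⊕ Fin m) : TwoGraph θ := PresentedMonoid.of (TwoGraphRel θ) x

/-- The degree homomorphism which gives `e_i` the degree `a` and `f_j` the degree `b`. -/
def weightHom (a b : ℕ) : TwoGraph θ →* Multiplicative ℕ :=
  PresentedMonoid.lift (Sum.elim (fun _ => Multiplicative.ofAdd a) fun _ => Multiplicative.ofAdd b)
    (by
      rintro _ _ ⟨i, j⟩
      simp [mul_comm])

/-- The degree function which gives `e_i` the degree `a` and `f_j` the degree `b`. -/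
def weight (a b : ℕ) (s : TwoGraph θ) : ℕ := (weightHom θ a b s).toAdd

theorem weight_mul (a b : ℕ) (s t : TwoGraph θ) :
    weight θ a b (s * t) = weight θ a b s + weight θ a b t := by
  simp [weight]

theorem weight_one (a b : ℕ) : weight θ a b 1 = 0 := by
  simp [weight]

theorem weight_gen (a b : ℕ) (x : Fin n ⊕ Fin m) :
    weight θ a b (gen θ x) = Sum.elim (fun _ => a) (fun _ => b) x := by
  rcases x <;> rfl

theorem exists_list (s : TwoGraph θ) : ∃ l : List (Fin n ⊕ Fin m), (l.map (gen θ)).prod = s := by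
  obtain ⟨w, rfl⟩ := PresentedMonoid.surjective_mk s
  induction w with
  | one => exact ⟨[], by simp⟩
  | of x => exact ⟨[x], by simp [gen, PresentedMonoid.of]⟩
  | mul x y hx hy =>
    obtain ⟨l, hl⟩ := hx
    obtain ⟨l', hl'⟩ := hy
    exact ⟨l ++ l', by simp [hl, hl']⟩

theorem weight_prod (l : List (Fin n ⊕ Fin m)) :
    weight θ 1 1 (l.map (gen θ)).prod = l.length := by
  induction l with
  | nil => simp [weight_one]
  | cons x l ih =>
    rw [List.map_cons, List.prod_cons, weight_mul, ih, weight_gen, List.length_cons, add_comm]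
    rcases x <;> rfl

theorem finite_weight_eq (k : ℕ) : {s : TwoGraph θ | weight θ 1 1 s = k}.Finite := by
  refine ((List.finite_length_eq (Fin n ⊕ Fin m) k).image fun l => (l.map (gen θ)).prod).subset ?_
  intro s hs
  obtain ⟨l, rfl⟩ := exists_list θ s
  exact ⟨l, by rw [← hs.out, weight_prod]; rfl, rfl⟩

theorem actBy_gen (x : Fin n ⊕ Fin m) (p : List (Fin n) × List (Fin m)) :
    actBy θ (gen θ x) p = act θ x p := rfl

theorem gen_injective : Function.Injective (gen θ) := by
  intro x y h
  have h1 := congrArg (fun s => actBy θ s ([], [])) h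
  simp only [actBy_gen] at h1
  rcases x with x | x <;> rcases y with y | y <;> simp_all [act, slide]

theorem gen_mul_gen_iff (x y x' y' : Fin n ⊕ Fin m) :
    gen θ x * gen θ y = gen θ x' * gen θ y' ↔
      act θ y (act θ x ([], [])) = act θ y' (act θ x' ([], [])) := by
  constructor
  · intro h
    simpa only [actBy_mul, actBy_gen] using congrArg (fun s => actBy θ s ([], [])) h
  · intro h
    have h1 := congrArg (eval θ) h
    have h2 : eval θ ([], []) = 1 := by simp [eval]
    simp only [eval_act, h2, one_mul] at h1
    exact h1

theorem inl_mul_inr (i : Fin n) (j : Fin m) :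
    gen θ (.inl i) * gen θ (.inr j) = gen θ (.inr (θ (i, j)).2) * gen θ (.inl (θ (i, j)).1) :=
  of_inl_mul_of_inr θ i j

theorem inr_mul_inl (i : Fin n) (j : Fin m) :
    gen θ (.inr j) * gen θ (.inl i) =
      gen θ (.inl (θ.symm (i, j)).1) * gen θ (.inr (θ.symm (i, j)).2) := by
  simp [inl_mul_inr]

theorem isGraded : FockSpace.IsGraded (gen θ) (weight θ 1 1) where
  map_mul := weight_mul θ 1 1
  map_gen x := by rw [weight_gen]; rcases x <;> rfl
  eq_one s hs := by
    obtain ⟨l, rfl⟩ := exists_list θ s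
    rw [weight_prod, List.length_eq_zero_iff] at hs
    simp [hs]
  exists_gen s hs := by
    obtain ⟨l, rfl⟩ := exists_list θ s
    rw [weight_prod, List.length_eq_one_iff] at hs
    obtain ⟨x, rfl⟩ := hs
    exact ⟨x, by simp⟩
  injective := gen_injective θ

theorem exists_inl_mul (l : List (Fin n ⊕ Fin m)) (hl : weight θ 1 0 (l.map (gen θ)).prod ≠ 0) :
    ∃ i u, gen θ (.inl i) * u = (l.map (gen θ)).prod := by
  induction l with
  | nil => simp [weight_one] at hl
  | cons x l ih =>
    rw [List.map_cons, List.prod_cons] at hl ⊢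
    rcases x with i | j
    · exact ⟨i, _, rfl⟩
    · rw [weight_mul, weight_gen, Sum.elim_inr, zero_add] at hl
      obtain ⟨i, u, hu⟩ := ih hl
      exact ⟨(θ.symm (i, j)).1, gen θ (.inr (θ.symm (i, j)).2) * u, by
        rw [← hu, ← mul_assoc, ← inr_mul_inl, mul_assoc]⟩

theorem exists_inr_mul (l : List (Fin n ⊕ Fin m)) (hl : weight θ 0 1 (l.map (gen θ)).prod ≠ 0) :
    ∃ j u, gen θ (.inr j) * u = (l.map (gen θ)).prod := by
  induction l with
  | nil => simp [weight_one] at hl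
  | cons x l ih =>
    rw [List.map_cons, List.prod_cons] at hl ⊢
    rcases x with i | j
    · rw [weight_mul, weight_gen, Sum.elim_inl, zero_add] at hl
      obtain ⟨j, u, hu⟩ := ih hl
      exact ⟨(θ (i, j)).2, gen θ (.inl (θ (i, j)).1) * u, by
        rw [← hu, ← mul_assoc, ← inl_mul_inr, mul_assoc]⟩
    · exact ⟨j, _, rfl⟩

theorem exists_actBy_fst (s : TwoGraph θ) (p : List (Fin n) × List (Fin m)) :
    ∃ l, (actBy θ s p).1 = l ++ p.1 := by
  obtain ⟨w, rfl⟩ := PresentedMonoid.surjective_mk s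
  induction w generalizing p with
  | one => exact ⟨[], by rw [map_one, actBy_one]; rfl⟩
  | of x =>
    rw [actBy_of]
    rcases x with i | j
    · exact ⟨[(slide θ i p.2).1], rfl⟩
    · exact ⟨[], rfl⟩
  | mul x y hx hy =>
    obtain ⟨l, hl⟩ := hx p
    obtain ⟨l', hl'⟩ := hy (actBy θ (PresentedMonoid.mk (TwoGraphRel θ) x) p)
    exact ⟨l' ++ l, by rw [map_mul, actBy_mul, hl', hl, List.append_assoc]⟩

theorem isLetters_inl : FockSpace.IsLetters (fun i => gen θ (.inl i)) (weight θ 1 0) where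
  map_mul := weight_mul θ 1 0
  map_letter i := weight_gen θ 1 0 _
  exists_mul_eq s hs := by
    obtain ⟨l, rfl⟩ := exists_list θ s
    exact exists_inl_mul θ l hs
  eq_of_mul_eq i k u u' h := by
    have h1 := congrArg (fun s => (actBy θ s ([], [])).1) h
    simp only [actBy_mul, actBy_gen] at h1
    obtain ⟨l, hl⟩ := exists_actBy_fst θ u (act θ (.inl i) ([], []))
    obtain ⟨l', hl'⟩ := exists_actBy_fst θ u' (act θ (.inl k) ([], []))
    rw [hl, hl'] at h1
    -- The `e`-word is stored with its last letter first and acting only prepends, so the leading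
    -- letter stays at the end of the list.
    simpa [act, slide] using congrArg List.getLast? h1

theorem isLetters_inr : FockSpace.IsLetters (fun j => gen θ (.inr j)) (weight θ 0 1) where
  map_mul := weight_mul θ 0 1
  map_letter i := weight_gen θ 0 1 _
  exists_mul_eq s hs := by
    obtain ⟨l, rfl⟩ := exists_list θ s
    exact exists_inr_mul θ l hs
  eq_of_mul_eq j k u u' h := by
    have hrev : ∀ l, (rev θ (gen θ (.inr l))).unop = gen θ.symm (.inr l) := fun l => rfl
    -- After reversal the leading `f` acts last, so it is the head of the stored `f`-word.
    have h1 := congrArg (fun s => (actBy θ.symm (rev θ s).unop ([], [])).2) h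
    simp only [_root_.map_mul, MulOpposite.unop_mul, actBy_mul, hrev, actBy_gen, act,
      List.cons.injEq] at h1
    exact h1.1

/-! ### Coefficients in degree two -/

theorem gen_mul_gen_eq_inl_inl (x y : Fin n ⊕ Fin m) (a b : Fin n) :
    gen θ x * gen θ y = gen θ (.inl a) * gen θ (.inl b) ↔ x = .inl a ∧ y = .inl b := by
  rw [gen_mul_gen_iff]
  rcases x with x | x <;> rcases y with y | y <;> simp [act, slide, and_comm]

theorem gen_mul_gen_eq_inr_inr (x y : Fin n ⊕ Fin m) (a b : Fin m) :
    gen θ x * gen θ y = gen θ (.inr a) * gen θ (.inr b) ↔ x = .inr a ∧ y = .inr b := by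
  rw [gen_mul_gen_iff]
  rcases x with x | x <;> rcases y with y | y <;> simp [act, slide, and_comm]

theorem gen_mul_gen_eq_inl_inr (x y : Fin n ⊕ Fin m) (a : Fin n) (b : Fin m) :
    gen θ x * gen θ y = gen θ (.inl a) * gen θ (.inr b) ↔
      x = .inl a ∧ y = .inr b ∨ x = .inr (θ (a, b)).2 ∧ y = .inl (θ (a, b)).1 := by
  rw [gen_mul_gen_iff]
  rcases x with x | x <;> rcases y with y | y <;> simp [act, slide]
  have : θ.symm (y, x) = (a, b) ↔ x = (θ (a, b)).2 ∧ y = (θ (a, b)).1 := by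
    rw [Equiv.symm_apply_eq, Prod.ext_iff, and_comm]
  rw [← this, Prod.ext_iff]

variable {b b' : FockSpace (TwoGraph θ) →L[ℂ] FockSpace (TwoGraph θ)}

open FockSpace

theorem weight_gen_mul_gen (x y : Fin n ⊕ Fin m) : weight θ 1 1 (gen θ x * gen θ y) = 2 := by
  rw [weight_mul, (isGraded θ).map_gen, (isGraded θ).map_gen]

theorem coef_mul_inl_inl (hb : ∀ v, Commute (lShift v) b) (h1 : coef b 1 = 0)
    (h1' : coef b' 1 = 0) (k l : Fin n) :
    coef (b * b') (gen θ (.inl k) * gen θ (.inl l)) =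
      coef b' (gen θ (.inl k)) * coef b (gen θ (.inl l)) := by
  rw [(isGraded θ).coef_mul_of_two hb h1 h1' (weight_gen_mul_gen θ _ _)]
  simp [gen_mul_gen_eq_inl_inl, ite_and]

theorem coef_mul_inr_inr (hb : ∀ v, Commute (lShift v) b) (h1 : coef b 1 = 0)
    (h1' : coef b' 1 = 0) (k l : Fin m) :
    coef (b * b') (gen θ (.inr k) * gen θ (.inr l)) =
      coef b' (gen θ (.inr k)) * coef b (gen θ (.inr l)) := by
  rw [(isGraded θ).coef_mul_of_two hb h1 h1' (weight_gen_mul_gen θ _ _)]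
  simp [gen_mul_gen_eq_inr_inr, ite_and]

/-- A mixed word of length two has exactly two factorizations into generators, exchanged by the
relation. -/
theorem coef_mul_inl_inr (hb : ∀ v, Commute (lShift v) b) (h1 : coef b 1 = 0)
    (h1' : coef b' 1 = 0) (k : Fin n) (l : Fin m) :
    coef (b * b') (gen θ (.inl k) * gen θ (.inr l)) =
      coef b' (gen θ (.inl k)) * coef b (gen θ (.inr l)) +
        coef b' (gen θ (.inr (θ (k, l)).2)) * coef b (gen θ (.inl (θ (k, l)).1)) := by
  rw [(isGraded θ).coef_mul_of_two hb h1 h1' (weight_gen_mul_gen θ _ _)]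
  simp [gen_mul_gen_eq_inl_inr, ite_and]

end TwoGraph

/-! ### Isometric isomorphisms onto the commutant -/

namespace FockSpace

variable {S : Type*} [Monoid S]

/-- The equality case of Cauchy–Schwarz for the vacuum vector and its image under a contraction. -/
theorem apply_fockBasis_one_of_coef {b : FockSpace S →L[ℂ] FockSpace S} (hb : ‖b‖ ≤ 1)
    (h : coef b 1 = 1) : b (fockBasis 1) = fockBasis 1 := by
  have h1 : ‖b (fockBasis 1)‖ ≤ 1 := by
    refine (b.le_of_opNorm_le hb _).trans ?_
    rw [norm_fockBasis, one_mul]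
  have h2 := norm_sub_sq (𝕜 := ℂ) (b (fockBasis 1)) (fockBasis 1)
  have h3 : ⟪b (fockBasis 1), fockBasis 1⟫_ℂ = 1 := by
    rw [inner_fockBasis_right]
    rw [coef] at h
    rw [h, _root_.map_one]
  rw [h3, norm_fockBasis] at h2
  have h4 : ‖b (fockBasis 1) - fockBasis 1‖ ^ 2 ≤ 0 := by
    rw [h2, RCLike.one_re]
    nlinarith [norm_nonneg (b (fockBasis 1))]
  have h5 := pow_eq_zero_iff two_ne_zero |>.1 (le_antisymm h4 (by positivity))
  exact sub_eq_zero.1 (norm_eq_zero.1 h5)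

variable [IsCancelMul S]

theorem commute_of_mem_commutant {b : FockSpace S →L[ℂ] FockSpace S}
    (hb : b ∈ commutant (analyticToeplitz S)) (v : S) : Commute (lShift v) b :=
  mem_commutant_iff.1 hb v

theorem rShift_mem_commutant (v : S) : rShift v ∈ commutant (analyticToeplitz S) :=
  mem_commutant_iff.2 fun w => lShift_commute_rShift w v

/-- The left shifts as elements of the analytic Toeplitz algebra. -/
def shiftElem (v : S) : analyticToeplitz S := ⟨lShift v, lShift_mem v⟩

theorem shiftElem_mul (v w : S) : shiftElem (v * w) = shiftElem v * shiftElem w :=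
  Subtype.ext (lShift_mul v w)

/-- The coefficient of an operator as a linear functional. -/
def coefLM (v : S) : (FockSpace S →L[ℂ] FockSpace S) →ₗ[ℂ] ℂ where
  toFun T := coef T v
  map_add' _ _ := rfl
  map_smul' _ _ := rfl

variable (Φ : analyticToeplitz S ≃ₐ[ℂ] commutant (analyticToeplitz S))

/-- The vacuum character of the commutant pulls back to a character in the interior of the ball. -/
theorem IsLetters.sum_norm_sq_coef_lt_one
    (hΦ : ∀ T, ‖(Φ T : FockSpace S →L[ℂ] FockSpace S)‖ = ‖(T : FockSpace S →L[ℂ] FockSpace S)‖)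
    {ι : Type*} [Fintype ι] {g : ι → S} {d : S → ℕ}
    (hg : IsLetters g d) : ∑ i, ‖coef (Φ (shiftElem (g i)) : FockSpace S →L[ℂ] FockSpace S) 1‖ ^ 2
      < 1 := by
  set α : ι → ℂ := fun i => coef (Φ (shiftElem (g i)) : FockSpace S →L[ℂ] FockSpace S) 1 with hα
  -- The conjugate coefficients make the vacuum coefficient of `Φ T` equal to `s`, while the norm of
  -- `T` is at most `√s`.
  set T : analyticToeplitz S := ∑ i, starRingEnd ℂ (α i) • shiftElem (g i) with hT
  set s := ∑ i, ‖α i‖ ^ 2 with hs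
  have hs0 : 0 ≤ s := Finset.sum_nonneg fun i _ => by positivity
  have hTval : (T : FockSpace S →L[ℂ] FockSpace S) =
      ∑ i, starRingEnd ℂ (α i) • lShift (g i) := by
    rw [hT]
    push_cast
    rfl
  have hTn : ‖(Φ T : FockSpace S →L[ℂ] FockSpace S)‖ ≤ √s := by
    rw [hΦ, hTval]
    simpa using hg.norm_sum_smul_lShift_le fun i => starRingEnd ℂ (α i)
  have hc : coef (Φ T : FockSpace S →L[ℂ] FockSpace S) 1 = s := by
    have h1 : (Φ T : FockSpace S →L[ℂ] FockSpace S) = ∑ i, starRingEnd ℂ (α i) •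
        (Φ (shiftElem (g i)) : FockSpace S →L[ℂ] FockSpace S) := by
      rw [hT, map_sum]
      push_cast
      simp
    rw [h1, coef_sum, hs]
    push_cast
    refine Finset.sum_congr rfl fun i _ => ?_
    rw [coef_smul]
    exact Complex.conj_mul' _
  have hle : s ≤ √s := by
    have := (norm_coef_le (Φ T : FockSpace S →L[ℂ] FockSpace S) 1).trans hTn
    rwa [hc, Complex.norm_real, Real.norm_of_nonneg hs0] at this
  have hsq := Real.sq_sqrt hs0
  -- If `s = 1`, the contraction `Φ T` fixes the vacuum, hence is the identity; then `T = 1`,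
  -- although `T` has no constant term.
  refine lt_of_le_of_ne (by nlinarith [Real.sqrt_nonneg s]) fun h1 => ?_
  rw [h1] at hTn hc
  have h2 := eq_one_of_apply_eq (commute_of_mem_commutant (Φ T).2)
    (apply_fockBasis_one_of_coef (by simpa using hTn) (by simpa using hc))
  have h3 : Φ T = 1 := Subtype.ext h2
  have h4 : T = 1 := by simpa using congrArg Φ.symm h3
  have h5 : coef (T : FockSpace S →L[ℂ] FockSpace S) 1 = 1 := by
    rw [h4]
    exact fockBasis_apply_self 1
  rw [hTval, coef_sum, Finset.sum_eq_zero] at h5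
  · exact zero_ne_one h5
  · intro i _
    rw [coef_smul, coef, lShift_fockBasis, mul_one, fockBasis_apply_ne, mul_zero]
    intro h6
    have h7 := hg.map_letter i
    have h8 := hg.map_mul 1 1
    rw [← h6] at h7
    rw [mul_one] at h8
    omega

end FockSpace

/-! ### Point derivations at the pulled-back vacuum character -/

namespace TwoGraph

open FockSpace

variable {n m : ℕ} {θ : Equiv.Perm (Fin n × Fin m)}
  (Φ : analyticToeplitz (TwoGraph θ) ≃ₐ[ℂ] commutant (analyticToeplitz (TwoGraph θ)))

theorem mem_iff_commute {T : FockSpace (TwoGraph θ) →L[ℂ] FockSpace (TwoGraph θ)} :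
    T ∈ analyticToeplitz (TwoGraph θ) ↔ ∀ v, Commute T (rShift v) :=
  mem_analyticToeplitz_iff _ (weight_mul θ 1 1) (finite_weight_eq θ)

theorem weight_add (s : TwoGraph θ) : weight θ 1 1 s = weight θ 1 0 s + weight θ 0 1 s := by
  obtain ⟨l, rfl⟩ := exists_list θ s
  induction l with
  | nil => simp [weight_one]
  | cons x l ih =>
    simp only [List.map_cons, List.prod_cons, weight_mul, ih, weight_gen]
    rcases x with x | x <;> simp <;> omega

/-- The matrix of coefficients of degree one of the images of the generators. -/
def linearPart : Matrix (Fin n ⊕ Fin m) (Fin n ⊕ Fin m) ℂ := fun x y =>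
  coef (Φ (shiftElem (gen θ x)) : FockSpace (TwoGraph θ) →L[ℂ] FockSpace (TwoGraph θ)) (gen θ y)

theorem coef_image_mul_gen (T T' : analyticToeplitz (TwoGraph θ)) (y : Fin n ⊕ Fin m) :
    coef (Φ (T * T') : FockSpace (TwoGraph θ) →L[ℂ] FockSpace (TwoGraph θ)) (gen θ y) =
      coef (Φ T : FockSpace (TwoGraph θ) →L[ℂ] FockSpace (TwoGraph θ)) (gen θ y) *
        coef (Φ T' : FockSpace (TwoGraph θ) →L[ℂ] FockSpace (TwoGraph θ)) 1 +
      coef (Φ T : FockSpace (TwoGraph θ) →L[ℂ] FockSpace (TwoGraph θ)) 1 *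
        coef (Φ T' : FockSpace (TwoGraph θ) →L[ℂ] FockSpace (TwoGraph θ)) (gen θ y) := by
  rw [map_mul]
  exact (isGraded θ).coef_mul_gen (commute_of_mem_commutant (Φ T).2) _ y

/-- By the Leibniz rule, `c` in the kernel gives a functional on which each generator acts as the
scalar `ψ`. It also kills `1`, so it is zero; evaluating at the preimage of `R_y` then reads off `c
y`. -/
theorem eq_zero_of_linearPart_mulVec
    (hΦ : ∀ T, ‖(Φ T : FockSpace (TwoGraph θ) →L[ℂ] FockSpace (TwoGraph θ))‖ =
      ‖(T : FockSpace (TwoGraph θ) →L[ℂ] FockSpace (TwoGraph θ))‖)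
     (c : Fin n ⊕ Fin m → ℂ)
    (hc : (linearPart Φ).mulVec c = 0) : c = 0 := by
  set D : analyticToeplitz (TwoGraph θ) →ₗ[ℂ] ℂ := ∑ y, c y • (coefLM (gen θ y) ∘ₗ
    (commutant (analyticToeplitz (TwoGraph θ))).val.toLinearMap ∘ₗ Φ.toLinearMap) with hD
  have hDe : ∀ T, D T = ∑ y, c y *
      coef (Φ T : FockSpace (TwoGraph θ) →L[ℂ] FockSpace (TwoGraph θ)) (gen θ y) := by
    intro T
    simp only [hD, LinearMap.sum_apply, LinearMap.smul_apply, smul_eq_mul]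
    rfl
  -- A purely algebraic extension suffices: boundedness is needed only on the commutant of the right
  -- shifts, where it comes from the isometry of `Φ`.
  obtain ⟨δ, hδ⟩ := LinearMap.exists_extend
    (p := Subalgebra.toSubmodule (analyticToeplitz (TwoGraph θ))) D
  have hδe : ∀ T : analyticToeplitz (TwoGraph θ), δ T = D T := fun T =>
    congrArg (fun f => f T) hδ
  have hbound : ∀ X, (∀ v, Commute X (rShift v)) → ‖δ X‖ ≤ (∑ y, ‖c y‖) * ‖X‖ := by
    intro X hX
    have h1 := hδe ⟨X, mem_iff_commute.2 hX⟩
    simp only at h1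
    rw [h1, hDe, Finset.sum_mul]
    refine (norm_sum_le _ _).trans (Finset.sum_le_sum fun y _ => ?_)
    rw [norm_mul]
    gcongr
    refine (norm_coef_le _ _).trans ?_
    rw [hΦ]
  have hmul : ∀ x X, (∀ v, Commute X (rShift v)) → δ (lShift (gen θ x) * X) =
      coef (Φ (shiftElem (gen θ x)) : FockSpace (TwoGraph θ) →L[ℂ] FockSpace (TwoGraph θ)) 1 *
        δ X := by
    intro x X hX
    have h1 := hδe (shiftElem (gen θ x) * ⟨X, mem_iff_commute.2 hX⟩)
    have h2 := hδe ⟨X, mem_iff_commute.2 hX⟩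
    refine h1.trans ?_
    refine Eq.trans ?_ (congrArg _ h2.symm)
    have h3 := congrFun hc x
    simp only [Matrix.mulVec, dotProduct, linearPart, Pi.zero_apply] at h3
    simp only [hDe, coef_image_mul_gen, mul_add, Finset.sum_add_distrib, Finset.mul_sum]
    have h4 : ∀ a : ℂ, ∑ y, c y * (coef (Φ (shiftElem (gen θ x)) :
        FockSpace (TwoGraph θ) →L[ℂ] FockSpace (TwoGraph θ)) (gen θ y) * a) = 0 := by
      intro a
      rw [← zero_mul a, ← h3, Finset.sum_mul]
      exact Finset.sum_congr rfl fun y _ => by ring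
    rw [h4, zero_add]
    exact Finset.sum_congr rfl fun y _ => by ring
  have hone : δ 1 = 0 := by
    have h1 := hδe 1
    refine h1.trans ?_
    rw [hDe, map_one]
    refine Finset.sum_eq_zero fun y _ => ?_
    rw [OneMemClass.coe_one, coef_one, fockBasis_apply_ne ((isGraded θ).gen_ne_one y), mul_zero]
  have hzero : ∀ X, (∀ v, Commute X (rShift v)) → δ X = 0 := by
    intro X hX
    -- Strip the letters `e_i` first, then the `f_j` from operators supported on words without any
    -- `e_i`; only scalars remain.
    refine (isLetters_inl θ).functional_eq_zero _
      ((isLetters_inl θ).sum_norm_sq_coef_lt_one Φ hΦ) δ hbound (fun i => hmul (.inl i))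
      Set.univ (fun _ _ _ => trivial) (fun Y hY _ hY0 => ?_) hX fun v hv => absurd trivial hv
    refine (isLetters_inr θ).functional_eq_zero _
      ((isLetters_inr θ).sum_norm_sq_coef_lt_one Φ hΦ) δ hbound (fun j => hmul (.inr j))
      {s | weight θ 1 0 s = 0} (fun j u hu => ?_) (fun Z hZ hZU hZ0 => ?_) hY hY0
    · have := hu.out
      rw [weight_mul] at this
      exact (Nat.add_eq_zero_iff.1 this).2
    · have h1 : Z = coef Z 1 • 1 := by
        refine eq_of_coef_eq hZ (fun v => (Commute.one_left _).smul_left _) fun v => ?_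
        rw [coef_smul, coef_one]
        by_cases hv : v = 1
        · rw [hv, fockBasis_apply_self, mul_one]
        · rw [fockBasis_apply_ne hv, mul_zero]
          by_cases h2 : weight θ 1 0 v = 0
          · refine hZ0 v fun h3 => hv ((isGraded θ).eq_one v ?_)
            rw [weight_add, h2, h3]
          · exact hZU v h2
      rw [h1, map_smul, hone, smul_zero]
  funext y
  have h1 := hδe (Φ.symm ⟨rShift (gen θ y), rShift_mem_commutant _⟩)
  rw [hzero _ (mem_iff_commute.1 (Φ.symm _).2), hDe, AlgEquiv.apply_symm_apply,
    Finset.sum_eq_single y] at h1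
  · simpa [coef, fockBasis_apply_self] using h1.symm
  · intro z _ hz
    simp only [coef, rShift_fockBasis, one_mul]
    rw [fockBasis_apply_ne fun h => hz (gen_injective θ h), mul_zero]
  · simp

theorem isUnit_det_linearPart
    (hΦ : ∀ T, ‖(Φ T : FockSpace (TwoGraph θ) →L[ℂ] FockSpace (TwoGraph θ))‖ =
      ‖(T : FockSpace (TwoGraph θ) →L[ℂ] FockSpace (TwoGraph θ))‖) : IsUnit (linearPart Φ).det := by
  rw [isUnit_iff_ne_zero]
  intro h
  obtain ⟨c, hc, hc0⟩ := Matrix.exists_mulVec_eq_zero_iff.2 h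
  exact hc (eq_zero_of_linearPart_mulVec Φ hΦ c hc0)

/-- The relations of the 2-graph in degree one. -/
theorem tangent_relation
    (hΦ : ∀ T, ‖(Φ T : FockSpace (TwoGraph θ) →L[ℂ] FockSpace (TwoGraph θ))‖ =
      ‖(T : FockSpace (TwoGraph θ) →L[ℂ] FockSpace (TwoGraph θ))‖)
     (a : Fin n ⊕ Fin m → ℂ) (i : Fin n) (j : Fin m) :
    let ψ := fun x => coef (Φ (shiftElem (gen θ x)) :
      FockSpace (TwoGraph θ) →L[ℂ] FockSpace (TwoGraph θ)) 1
    a (.inl i) * ψ (.inr j) + ψ (.inl i) * a (.inr j) =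
      a (.inr (θ (i, j)).2) * ψ (.inl (θ (i, j)).1) +
        ψ (.inr (θ (i, j)).2) * a (.inl (θ (i, j)).1) := by
  intro ψ
  have hrel : shiftElem (gen θ (.inl i)) * shiftElem (gen θ (.inr j)) =
      shiftElem (gen θ (.inr (θ (i, j)).2)) * shiftElem (gen θ (.inl (θ (i, j)).1)) := by
    rw [← shiftElem_mul, inl_mul_inr, shiftElem_mul]
  -- Invertibility makes every tangent vector `a` a combination of the columns of `linearPart Φ`,
  -- each of which satisfies the relation by the Leibniz rule.
  obtain ⟨c, rfl⟩ := (Matrix.mulVec_surjective_iff_isUnit (A := linearPart Φ)).2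
    ((Matrix.isUnit_iff_isUnit_det _).2 (isUnit_det_linearPart Φ hΦ)) a
  simp only [Matrix.mulVec, dotProduct, Finset.sum_mul, Finset.mul_sum, ← Finset.sum_add_distrib]
  refine Finset.sum_congr rfl fun y _ => ?_
  have h := congrArg (fun T => coef (Φ T : FockSpace (TwoGraph θ) →L[ℂ] FockSpace (TwoGraph θ))
    (gen θ y) * c y) hrel
  simp only [coef_image_mul_gen] at h
  simp only [linearPart, ψ]
  linear_combination h

end TwoGraph

/-! ### The permutation `(1 2 4 6 5 3)` -/

theorem theta124653_apply :
    theta124653 (0, 0) = (0, 1) ∧ theta124653 (0, 1) = (1, 0) ∧ theta124653 (1, 0) = (1, 2) ∧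
    theta124653 (1, 2) = (1, 1) ∧ theta124653 (1, 1) = (0, 2) ∧ theta124653 (0, 2) = (0, 0) := by
  decide

/-- The permutation and its inverse are not conjugate by an elementary tensor. -/
theorem det_eq_zero_or_of_tensor (E : Fin 2 → Fin 2 → ℂ) (F : Fin 3 → Fin 3 → ℂ)
    (h : ∀ i j k l, F j (theta124653 (k, l)).2 * E i (theta124653 (k, l)).1 =
      E (theta124653 (i, j)).1 k * F (theta124653 (i, j)).2 l) :
    Matrix.det (Matrix.of E) = 0 ∨ Matrix.det (Matrix.of F) = 0 := by
  obtain ⟨t1, t2, t3, t4, t5, t6⟩ := theta124653_apply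
  simp only [Fin.forall_fin_succ, Fin.succ_zero_eq_one, Fin.succ_one_eq_two, IsEmpty.forall_iff,
    and_true, t1, t2, t3, t4, t5, t6] at h
  rw [Matrix.det_fin_two, Matrix.det_fin_three]
  simp only [Matrix.of_apply]
  -- With `A = E ⊗ F`, the hypothesis reads `A (x, θ y) = A (θ x, y)`. Since `θ` is a 6-cycle, the
  -- entries of `A` along it depend only on the sum of the positions mod 6; elimination shows this
  -- incompatible with two nonzero determinants.
  by_contra! hc
  grind

/-- A linear map which respects the quadratic relations of the 2-graph and of its opposite does
not take the `e_i` into the span of the `e_i` and the `f_j` bijectively. -/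
theorem det_eq_zero_of_relations (M : Matrix (Fin 2 ⊕ Fin 3) (Fin 2 ⊕ Fin 3) ℂ)
    (hff : ∀ i j k l, M (.inr j) (.inr k) * M (.inl i) (.inr l) =
      M (.inl (theta124653 (i, j)).1) (.inr k) * M (.inr (theta124653 (i, j)).2) (.inr l))
    (hee : ∀ i j k l, M (.inr j) (.inl k) * M (.inl i) (.inl l) =
      M (.inl (theta124653 (i, j)).1) (.inl k) * M (.inr (theta124653 (i, j)).2) (.inl l))
    (hef : ∀ i j k l, M (.inr j) (.inl k) * M (.inl i) (.inr l) +
        M (.inr j) (.inr (theta124653 (k, l)).2) * M (.inl i) (.inl (theta124653 (k, l)).1) =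
      M (.inl (theta124653 (i, j)).1) (.inl k) * M (.inr (theta124653 (i, j)).2) (.inr l) +
        M (.inl (theta124653 (i, j)).1) (.inr (theta124653 (k, l)).2) *
          M (.inr (theta124653 (i, j)).2) (.inl (theta124653 (k, l)).1)) :
    M.det = 0 := by
  by_contra hdet
  have hinj : ∀ c, M.mulVec c = 0 → c = 0 := fun c hc => by
    by_contra h
    exact hdet (Matrix.exists_mulVec_eq_zero_iff.1 ⟨c, h, hc⟩)
  have hP : ∀ i l, M (.inl i) (.inr l) = 0 := by
    by_contra! hP
    obtain ⟨i, l, hil⟩ := hP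
    -- A 2 × 3 block has a kernel vector. If the block is nonzero, contracting `hff` with that
    -- vector shows the `f`-`f` block kills it too, so `M` is singular.
    obtain ⟨c, hc, hc0⟩ : ∃ c : Fin 3 → ℂ, c ≠ 0 ∧ M.toBlocks₁₂.mulVec c = 0 := by
      have h := LinearMap.ker_ne_bot_of_finrank_lt (f := M.toBlocks₁₂.mulVecLin) (by simp)
      obtain ⟨c, hc, hc0⟩ := Submodule.exists_mem_ne_zero_of_ne_bot h
      exact ⟨c, hc0, hc⟩
    have he : ∀ i, ∑ k, M (.inl i) (.inr k) * c k = 0 := fun i => congrFun hc0 i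
    have hf : ∀ j, ∑ k, M (.inr j) (.inr k) * c k = 0 := by
      intro j
      have h : (∑ k, M (.inr j) (.inr k) * c k) * M (.inl i) (.inr l) = 0 := by
        rw [← zero_mul (M (.inr (theta124653 (i, j)).2) (.inr l)), ← he (theta124653 (i, j)).1,
          Finset.sum_mul, Finset.sum_mul]
        exact Finset.sum_congr rfl fun k _ => by linear_combination c k * hff i j k l
      exact (mul_eq_zero.1 h).resolve_right hil
    have h := hinj (Sum.elim 0 c) (by
      funext x
      rcases x with x | x <;> simp [Matrix.mulVec, dotProduct, he, hf])
    exact hc (funext fun k => congrFun h (.inr k))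
  have hblock : M = Matrix.fromBlocks M.toBlocks₁₁ 0 M.toBlocks₂₁ M.toBlocks₂₂ := by
    ext x y
    rcases x with x | x <;> rcases y with y | y <;>
      simp [Matrix.toBlocks₁₁, Matrix.toBlocks₂₁, Matrix.toBlocks₂₂, hP]
  rw [hblock, Matrix.det_fromBlocks_zero₁₂, mul_eq_zero, not_or] at hdet
  obtain ⟨t1, t2, t3, t4, t5, t6⟩ := theta124653_apply
  have hG : ∀ j k, M (.inr j) (.inl k) = 0 := by
    have h1 := hdet.1
    rw [Matrix.det_fin_two] at h1
    simp only [Matrix.toBlocks₁₁, Matrix.of_apply] at h1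
    -- Both relations fix the row index of `E`. With `g_j` the rows of the lower left block, they
    -- read `g_0 ⊗ E_0 = E_0 ⊗ g_1` and `g_0 ⊗ E_1 = E_1 ⊗ g_2`. So `g_0 = g_1 = g_2` is a multiple
    -- of both independent rows of `E`, hence zero.
    have e1 := hee 0 0
    have e2 := hee 1 0
    simp only [t1, t3, Fin.forall_fin_two] at e1 e2
    simp only [Fin.forall_fin_succ, Fin.succ_zero_eq_one, Fin.succ_one_eq_two,
      IsEmpty.forall_iff, and_true]
    grind
  refine (det_eq_zero_or_of_tensor (fun i k => M (.inl i) (.inl k))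
    (fun j l => M (.inr j) (.inr l)) fun i j k l => ?_).elim hdet.1 hdet.2
  simpa [hP, hG] using hef i j k l

/-! ### Contradiction from an isometric isomorphism -/

open FockSpace TwoGraph

theorem not_isometricallyIsomorphic_commutant :
    ¬ IsometricallyIsomorphic (analyticToeplitz (TwoGraph theta124653))
        (commutant (analyticToeplitz (TwoGraph theta124653))) := by
  rintro ⟨Φ, hΦ⟩
  obtain ⟨t1, t2, t3, t4, t5, t6⟩ := theta124653_apply
  have htan := tangent_relation Φ hΦ
  have hψf : ∀ j, coef (Φ (shiftElem (gen theta124653 (.inr j))) :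
      FockSpace (TwoGraph theta124653) →L[ℂ] FockSpace (TwoGraph theta124653)) 1 = 0 := by
    -- In the direction of `e_1`, the cells of the first row give `ψ(f_1) = ψ(f_2)`, `ψ(f_2) = 0`
    -- and `ψ(f_3) = ψ(f_1)`.
    have h := fun i j => htan (Sum.elim ![1, 0] 0) i j
    have h1 := h 0 0
    have h2 := h 0 1
    have h3 := h 0 2
    simp [t1, t2, t6] at h1 h2 h3
    intro j
    fin_cases j
    · exact h1.trans h2
    · exact h2
    · exact h3.trans (h1.trans h2)
  have hψe : ∀ i, coef (Φ (shiftElem (gen theta124653 (.inl i))) :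
      FockSpace (TwoGraph theta124653) →L[ℂ] FockSpace (TwoGraph theta124653)) 1 = 0 := by
    -- In the direction of `f_1`: `θ` moves both cells of the first column out of that column, so
    -- each `ψ(e_i)` equals zero.
    have h := fun i j => htan (Sum.elim 0 ![1, 0, 0]) i j
    have h1 := h 0 0
    have h2 := h 1 0
    simp [t1, t3] at h1 h2
    intro i
    fin_cases i
    · exact h1
    · exact h2
  have hrel : ∀ i j, (Φ (shiftElem (gen theta124653 (.inl i))) *
      Φ (shiftElem (gen theta124653 (.inr j))) :
        FockSpace (TwoGraph theta124653) →L[ℂ] FockSpace (TwoGraph theta124653)) =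
      Φ (shiftElem (gen theta124653 (.inr (theta124653 (i, j)).2))) *
        Φ (shiftElem (gen theta124653 (.inl (theta124653 (i, j)).1))) := by
    intro i j
    have h := congrArg (fun s => (Φ (shiftElem s) :
      FockSpace (TwoGraph theta124653) →L[ℂ] FockSpace (TwoGraph theta124653)))
      (inl_mul_inr theta124653 i j)
    simpa only [shiftElem_mul, map_mul, MulMemClass.coe_mul] using h
  have hcomm := fun T => commute_of_mem_commutant (Φ T).2
  refine (isUnit_iff_ne_zero.1 (isUnit_det_linearPart Φ hΦ)) (det_eq_zero_of_relations _
    (fun i j k l => ?_) (fun i j k l => ?_) fun i j k l => ?_)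
  · have h := congrArg (fun T => coef T
      (gen theta124653 (.inr k) * gen theta124653 (.inr l))) (hrel i j)
    simp only [coef_mul_inr_inr _ (hcomm _) (hψe _) (hψf _),
      coef_mul_inr_inr _ (hcomm _) (hψf _) (hψe _)] at h
    exact h
  · have h := congrArg (fun T => coef T
      (gen theta124653 (.inl k) * gen theta124653 (.inl l))) (hrel i j)
    simp only [coef_mul_inl_inl _ (hcomm _) (hψe _) (hψf _),
      coef_mul_inl_inl _ (hcomm _) (hψf _) (hψe _)] at h
    exact h
  · have h := congrArg (fun T => coef T
      (gen theta124653 (.inl k) * gen theta124653 (.inr l))) (hrel i j)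
    simp only [coef_mul_inl_inr _ (hcomm _) (hψe _) (hψf _),
      coef_mul_inl_inr _ (hcomm _) (hψf _) (hψe _)] at h
    exact h

end

theorem corollary7p6 :
    -- the commutant of `𝔏_Λ` is `𝔏_{Λ^op}`, by the unitary which sends `ξ_w` to `ξ_{w^op}`
    (∃ W : FockSpace (TwoGraph theta124653) ≃ₗᵢ[ℂ] FockSpace (TwoGraph theta124653)ᵐᵒᵖ,
      (∀ w : TwoGraph theta124653, W (fockBasis w) = fockBasis (MulOpposite.op w)) ∧
      ∀ T : FockSpace (TwoGraph theta124653) →L[ℂ] FockSpace (TwoGraph theta124653),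
        T ∈ commutant (analyticToeplitz (TwoGraph theta124653)) ↔
          (W : FockSpace (TwoGraph theta124653) →L[ℂ] FockSpace (TwoGraph theta124653)ᵐᵒᵖ) ∘L T ∘L
            (W.symm : FockSpace (TwoGraph theta124653)ᵐᵒᵖ →L[ℂ] FockSpace (TwoGraph theta124653))
              ∈ analyticToeplitz (TwoGraph theta124653)ᵐᵒᵖ) ∧
    -- and it is not isometrically isomorphic to `𝔏_Λ`
    ¬ IsometricallyIsomorphic (analyticToeplitz (TwoGraph theta124653))
        (commutant (analyticToeplitz (TwoGraph theta124653))) := by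
  exact ⟨⟨FockSpace.opUnitary _, FockSpace.opUnitary_fockBasis,
    FockSpace.mem_commutant_iff_conj_mem _ (TwoGraph.weight_mul _ 1 1)
      (TwoGraph.finite_weight_eq _)⟩, not_isometricallyIsomorphic_commutant⟩
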